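/- Let $k$ be a field and let $A,B,C,D$ be finite-dimensional $k$-algebras. For finite-dimensional $k$-algebras $R,S$, an $R$-$S$-bimodule is a left module over $R\otimes_k S^{\mathrm{op}}$, and $\mathcal D^-(R\otimes_k S^{\mathrm{op}})$ denotes the derived category of bounded above complexes of finitely generated $R$-$S$-bimodules, i.e. the localization of the category of such complexes at the quasi-isomorphisms. Then the total left derived functors of the tensor product bifunctors on bounded above complexes exist; they are bifunctors $$-\otimes^{\mathbb L}_B-\colon \mathcal D^-(A\otimes_k B^{\mathrm{op}})\times\mathcal D^-(B\otimes_k C^{\mathrm{op}})\to\mathcal D^-(A\otimes_k C^{\mathrm{op}}),$$ and likewise $\mathcal D^-(A\otimes_k B^{\mathrm{op}})\times\mathcal D^-(B\otimes_k D^{\mathrm{op}})\to\mathcal D^-(A\otimes_k D^{\mathrm{op}})$ over $B$, and $-\otimes^{\mathbb L}_C-$ from $\mathcal D^-(A\otimes_k C^{\mathrm{op}})\times\mathcal D^-(C\otimes_k D^{\mathrm{op}})$ to $\mathcal D^-(A\otimes_k D^{\mathrm{op}})$ and from $\mathcal D^-(B\otimes_k C^{\mathrm{op}})\times\mathcal D^-(C\otimes_k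 D^{\mathrm{op}})$ to $\mathcal D^-(B\otimes_k D^{\mathrm{op}})$. Moreover, there is an isomorphism $$(L^*\otimes^{\mathbb L}_B M^*)\otimes^{\mathbb L}_C N^*\;\cong\;L^*\otimes^{\mathbb L}_B(M^*\otimes^{\mathbb L}_C N^*)$$ in $\mathcal D^-(A\otimes_k D^{\mathrm{op}})$, natural in all three factors $L^*\in\mathcal D^-(A\otimes_k B^{\mathrm{op}})$, $M^*\in\mathcal D^-(B\otimes_k C^{\mathrm{op}})$, $N^*\in\mathcal D^-(C\otimes_k D^{\mathrm{op}})$. In particular, for bounded complexes of bimodules $L^*$, $M^*$, $N^*$ there are natural isomorphisms of functors \begin{align*} (-\otimes^{\mathbb L}_B M^*)\otimes^{\mathbb L}_C N^*&\cong -\otimes^{\mathbb L}_B(M^*\otimes^{\mathbb L}_C N^*)\colon \mathcal D^-(A\otimes_k B^{\mathrm{op}})\to\mathcal D^-(A\otimes_k D^{\mathrm{op}}),\\ (L^*\otimes^{\mathbb L}_B -)\otimes^{\mathbb L}_C N^*&\cong L^*\otimes^{\mathbb L}_B(-\otimes^{\mathbb L}_C N^*)\colon \mathcal D^-(B\otimes_k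 C^{\mathrm{op}})\to\mathcal D^-(A\otimes_k D^{\mathrm{op}}),\\ (L^*\otimes^{\mathbb L}_B M^*)\otimes^{\mathbb L}_C -&\cong L^*\otimes^{\mathbb L}_B(M^*\otimes^{\mathbb L}_C -)\colon \mathcal D^-(C\otimes_k D^{\mathrm{op}})\to\mathcal D^-(A\otimes_k D^{\mathrm{op}}). \end{align*} -/

import Mathlib

open CategoryTheory Limits
open scoped TensorProduct

universe u

noncomputable section

namespace DerivedTensor

set_option linter.unusedSectionVars false

section BalancedTensor

/-! ### The tensor product `L ⊗_B M` of an `A`-`B`-bimodule and a `B`-`C`-bimodule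

An `A`-`B`-bimodule (with central action of the base field `k`) is a left module over
`A ⊗[k] Bᵐᵒᵖ`: `a l b = (a ⊗ op b) • l`. -/

variable (k A B C : Type u) [Field k] [Ring A] [Algebra k A] [Ring B] [Algebra k B]
  [Ring C] [Algebra k C]
variable (L M : Type u)
  [AddCommGroup L] [Module k L] [Module (A ⊗[k] Bᵐᵒᵖ) L] [IsScalarTower k (A ⊗[k] Bᵐᵒᵖ) L]
  [AddCommGroup M] [Module k M] [Module (B ⊗[k] Cᵐᵒᵖ) M] [IsScalarTower k (B ⊗[k] Cᵐᵒᵖ) M]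

/-- The subspace of `L ⊗[k] M` spanned by the elements `l b ⊗ m - l ⊗ b m`. -/
def balancedRelations : Submodule k (L ⊗[k] M) :=
  Submodule.span k {x | ∃ (l : L) (b : B) (m : M),
    x = (((1 : A) ⊗ₜ[k] MulOpposite.op b) • l) ⊗ₜ[k] m -
      l ⊗ₜ[k] ((b ⊗ₜ[k] (1 : Cᵐᵒᵖ)) • m)}

/-- The tensor product `L ⊗_B M`. -/
def BalancedTensor : Type u := (L ⊗[k] M) ⧸ balancedRelations k A B C L M

instance : AddCommGroup (BalancedTensor k A B C L M) :=
  inferInstanceAs (AddCommGroup ((L ⊗[k] M) ⧸ balancedRelations k A B C L M))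

instance : Module k (BalancedTensor k A B C L M) :=
  inferInstanceAs (Module k ((L ⊗[k] M) ⧸ balancedRelations k A B C L M))

/-- The projection `L ⊗[k] M → L ⊗_B M`. -/
def BalancedTensor.mk : L ⊗[k] M →ₗ[k] BalancedTensor k A B C L M :=
  (balancedRelations k A B C L M).mkQ

theorem BalancedTensor.mk_surjective :
    Function.Surjective (BalancedTensor.mk k A B C L M) :=
  Submodule.mkQ_surjective _

/-- The action of `A ⊗[k] Cᵐᵒᵖ` on `L ⊗[k] M`: `(a ⊗ op c)` sends `l ⊗ m` to `a l ⊗ m c`. -/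
def outerAction : A ⊗[k] Cᵐᵒᵖ →ₐ[k] Module.End k (L ⊗[k] M) :=
  (Module.endTensorEndAlgHom (R := k) (S := k) (A := k) (M := L) (N := M)).comp
    (Algebra.TensorProduct.map
      ((Algebra.lsmul k k L).comp
        (Algebra.TensorProduct.includeLeft : A →ₐ[k] A ⊗[k] Bᵐᵒᵖ))
      ((Algebra.lsmul k k M).comp
        (Algebra.TensorProduct.includeRight : Cᵐᵒᵖ →ₐ[k] B ⊗[k] Cᵐᵒᵖ)))

theorem outerAction_tmul (a : A) (c : Cᵐᵒᵖ) (l : L) (m : M) :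
    outerAction k A B C L M (a ⊗ₜ c) (l ⊗ₜ m) =
      ((a ⊗ₜ[k] (1 : Bᵐᵒᵖ)) • l) ⊗ₜ[k] (((1 : B) ⊗ₜ[k] c) • m) := by
  simp [outerAction, Module.endTensorEndAlgHom_apply]

theorem balancedRelations_le_comap (r : A ⊗[k] Cᵐᵒᵖ) :
    balancedRelations k A B C L M ≤
      (balancedRelations k A B C L M).comap (outerAction k A B C L M r) := by
  induction r using TensorProduct.induction_on with
  | zero => intro x _; simp
  | add r s hr hs =>
    intro x hx
    have := (balancedRelations k A B C L M).add_mem (hr hx) (hs hx)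
    simpa using this
  | tmul a c =>
    refine Submodule.span_le.2 ?_
    rintro _ ⟨l, b, m, rfl⟩
    refine Submodule.subset_span ⟨(a ⊗ₜ[k] (1 : Bᵐᵒᵖ)) • l, b, ((1 : B) ⊗ₜ[k] c) • m, ?_⟩
    rw [map_sub, outerAction_tmul, outerAction_tmul]
    simp only [smul_smul, Algebra.TensorProduct.tmul_mul_tmul, one_mul, mul_one]

/-- The action of `A ⊗[k] Cᵐᵒᵖ` on `L ⊗_B M`: `(a ⊗ op c)` sends `l ⊗ m` to `a l ⊗ m c`. -/
def balancedAction : A ⊗[k] Cᵐᵒᵖ →+* Module.End k (BalancedTensor k A B C L M) where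
  toFun r := (balancedRelations k A B C L M).mapQ (balancedRelations k A B C L M)
    (outerAction k A B C L M r) (balancedRelations_le_comap k A B C L M r)
  map_one' := by
    refine Submodule.linearMap_qext _ (LinearMap.ext fun x => ?_)
    simp
    rfl
  map_mul' r s := by
    refine Submodule.linearMap_qext _ (LinearMap.ext fun x => ?_)
    simp
    rfl
  map_zero' := by
    refine Submodule.linearMap_qext _ (LinearMap.ext fun x => ?_)
    simp
    rfl
  map_add' r s := by
    refine Submodule.linearMap_qext _ (LinearMap.ext fun x => ?_)
    simp
    rfl

instance : Module (A ⊗[k] Cᵐᵒᵖ) (BalancedTensor k A B C L M) :=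
  Module.compHom _ (balancedAction k A B C L M)

theorem smul_mk (r : A ⊗[k] Cᵐᵒᵖ) (x : L ⊗[k] M) :
    r • BalancedTensor.mk k A B C L M x =
      BalancedTensor.mk k A B C L M (outerAction k A B C L M r x) := rfl

instance : IsScalarTower k (A ⊗[k] Cᵐᵒᵖ) (BalancedTensor k A B C L M) where
  smul_assoc c r x := by
    obtain ⟨x, rfl⟩ := BalancedTensor.mk_surjective k A B C L M x
    rw [smul_mk, smul_mk, map_smul, LinearMap.smul_apply, map_smul]

instance [Module.Finite k L] [Module.Finite k M] :
    Module.Finite (A ⊗[k] Cᵐᵒᵖ) (BalancedTensor k A B C L M) := by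
  have : Module.Finite k (BalancedTensor k A B C L M) :=
    Module.Finite.of_surjective _ (BalancedTensor.mk_surjective k A B C L M)
  exact Module.Finite.of_restrictScalars_finite k _ _

variable {L M}
variable {L' M' : Type u}
  [AddCommGroup L'] [Module k L'] [Module (A ⊗[k] Bᵐᵒᵖ) L'] [IsScalarTower k (A ⊗[k] Bᵐᵒᵖ) L']
  [AddCommGroup M'] [Module k M'] [Module (B ⊗[k] Cᵐᵒᵖ) M'] [IsScalarTower k (B ⊗[k] Cᵐᵒᵖ) M']

theorem balancedRelations_le_comap_map (f : L →ₗ[A ⊗[k] Bᵐᵒᵖ] L') (g : M →ₗ[B ⊗[k] Cᵐᵒᵖ] M') :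
    balancedRelations k A B C L M ≤ (balancedRelations k A B C L' M').comap
      (TensorProduct.map (f.restrictScalars k) (g.restrictScalars k)) := by
  refine Submodule.span_le.2 ?_
  rintro _ ⟨l, b, m, rfl⟩
  exact Submodule.subset_span ⟨f l, b, g m, by simp⟩

/-- The map `f ⊗_B g : L ⊗_B M → L' ⊗_B M'`. -/
def BalancedTensor.map (f : L →ₗ[A ⊗[k] Bᵐᵒᵖ] L') (g : M →ₗ[B ⊗[k] Cᵐᵒᵖ] M') :
    BalancedTensor k A B C L M →ₗ[A ⊗[k] Cᵐᵒᵖ] BalancedTensor k A B C L' M' where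
  toFun := (balancedRelations k A B C L M).mapQ (balancedRelations k A B C L' M')
    (TensorProduct.map (f.restrictScalars k) (g.restrictScalars k))
    (balancedRelations_le_comap_map k A B C f g)
  map_add' x y := map_add _ x y
  map_smul' r x := by
    obtain ⟨x, rfl⟩ := BalancedTensor.mk_surjective k A B C L M x
    rw [smul_mk]
    change BalancedTensor.mk k A B C L' M' (TensorProduct.map (f.restrictScalars k)
      (g.restrictScalars k) (outerAction k A B C L M r x)) =
      r • BalancedTensor.mk k A B C L' M' (TensorProduct.map (f.restrictScalars k)
      (g.restrictScalars k) x)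
    rw [smul_mk]
    congr 1
    induction r using TensorProduct.induction_on with
    | zero => simp
    | add r s hr hs => simp only [map_add, LinearMap.add_apply, hr, hs]
    | tmul a c =>
      induction x using TensorProduct.induction_on with
      | zero => simp
      | add x y hx hy => simp only [map_add, hx, hy]
      | tmul l m => simp [outerAction_tmul]

theorem BalancedTensor.map_mk (f : L →ₗ[A ⊗[k] Bᵐᵒᵖ] L') (g : M →ₗ[B ⊗[k] Cᵐᵒᵖ] M')
    (x : L ⊗[k] M) :
    BalancedTensor.map k A B C f g (BalancedTensor.mk k A B C L M x) =
      BalancedTensor.mk k A B C L' M'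
        (TensorProduct.map (f.restrictScalars k) (g.restrictScalars k) x) := rfl

theorem BalancedTensor.hom_ext {X : Type u} [AddCommGroup X] [Module (A ⊗[k] Cᵐᵒᵖ) X]
    {f g : BalancedTensor k A B C L M →ₗ[A ⊗[k] Cᵐᵒᵖ] X}
    (h : ∀ l m, f (BalancedTensor.mk k A B C L M (l ⊗ₜ m)) =
      g (BalancedTensor.mk k A B C L M (l ⊗ₜ m))) : f = g := by
  ext x
  obtain ⟨x, rfl⟩ := BalancedTensor.mk_surjective k A B C L M x
  induction x using TensorProduct.induction_on with
  | zero => simp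
  | add x y hx hy => simp only [map_add, hx, hy]
  | tmul l m => exact h l m

end BalancedTensor

section Bimodules

variable (k A B C : Type u) [Field k] [Ring A] [Algebra k A] [Ring B] [Algebra k B]
  [Ring C] [Algebra k C]

/-- The category of finitely generated `A`-`B`-bimodules. -/
abbrev FGBimod := FGModuleCat.{u} (A ⊗[k] Bᵐᵒᵖ)

instance [FiniteDimensional k A] [FiniteDimensional k B] : IsNoetherianRing (A ⊗[k] Bᵐᵒᵖ) :=
  IsNoetherianRing.of_finite k _

variable {k A B} in
/-- The `k`-vector space underlying a bimodule. -/
instance (X : FGBimod k A B) : Module k X :=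
  Module.compHom X (algebraMap k (A ⊗[k] Bᵐᵒᵖ))

variable {k A B} in
instance (X : FGBimod k A B) : IsScalarTower k (A ⊗[k] Bᵐᵒᵖ) X where
  smul_assoc c r x :=
    (congrArg (fun s : A ⊗[k] Bᵐᵒᵖ => s • x) (Algebra.smul_def c r)).trans
      (mul_smul (algebraMap k (A ⊗[k] Bᵐᵒᵖ) c) r x)

variable {k A B} in
instance [FiniteDimensional k A] [FiniteDimensional k B] (X : FGBimod k A B) :
    Module.Finite k X :=
  Module.Finite.trans (A ⊗[k] Bᵐᵒᵖ) X

variable [FiniteDimensional k A] [FiniteDimensional k B] [FiniteDimensional k C]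

/-- The bifunctor `(L, M) ↦ L ⊗_B M` on finitely generated bimodules. -/
def tensorBimod : FGBimod k A B ⥤ FGBimod k B C ⥤ FGBimod k A C where
  obj L :=
    { obj M := FGModuleCat.of (A ⊗[k] Cᵐᵒᵖ) (BalancedTensor k A B C L M)
      map g := FGModuleCat.ofHom (BalancedTensor.map k A B C LinearMap.id g.hom.hom)
      map_id M := FGModuleCat.hom_ext (BalancedTensor.hom_ext k A B C fun _ _ => rfl)
      map_comp f g := FGModuleCat.hom_ext (BalancedTensor.hom_ext k A B C fun _ _ => rfl) }
  map f :=
    { app M := FGModuleCat.ofHom (BalancedTensor.map k A B C f.hom.hom LinearMap.id)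
      naturality M N g := FGModuleCat.hom_ext (BalancedTensor.hom_ext k A B C fun _ _ => rfl) }
  map_id L := by
    ext M : 2
    exact FGModuleCat.hom_ext (BalancedTensor.hom_ext k A B C fun _ _ => rfl)
  map_comp f g := by
    ext M : 2
    exact FGModuleCat.hom_ext (BalancedTensor.hom_ext k A B C fun _ _ => rfl)

instance : (tensorBimod k A B C).Additive where
  map_add {L L' f g} := by
    ext M : 2
    refine FGModuleCat.hom_ext (BalancedTensor.hom_ext k A B C fun l m => ?_)
    change BalancedTensor.mk k A B C L' M ((f.hom.hom l + g.hom.hom l) ⊗ₜ m) =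
      BalancedTensor.mk k A B C L' M (f.hom.hom l ⊗ₜ m) +
      BalancedTensor.mk k A B C L' M (g.hom.hom l ⊗ₜ m)
    rw [TensorProduct.add_tmul, map_add]

instance (L : FGBimod k A B) : ((tensorBimod k A B C).obj L).Additive where
  map_add {M M' f g} := by
    refine FGModuleCat.hom_ext (BalancedTensor.hom_ext k A B C fun l m => ?_)
    change BalancedTensor.mk k A B C L M' (l ⊗ₜ (f.hom.hom m + g.hom.hom m)) =
      BalancedTensor.mk k A B C L M' (l ⊗ₜ f.hom.hom m) +
      BalancedTensor.mk k A B C L M' (l ⊗ₜ g.hom.hom m)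
    rw [TensorProduct.tmul_add, map_add]

end Bimodules

section Complexes

/-! ### Bounded above complexes and the derived category `D⁻` -/

variable (𝒜 : Type*) [Category* 𝒜]

/-- The cochain complexes that vanish in all sufficiently large degrees. -/
def boundedAbove [HasZeroMorphisms 𝒜] : ObjectProperty (CochainComplex 𝒜 ℤ) :=
  fun K => ∃ n : ℤ, K.IsStrictlyLE n

/-- The category of bounded above cochain complexes. -/
abbrev CMinus [HasZeroMorphisms 𝒜] := (boundedAbove 𝒜).FullSubcategory

/-- The quasi-isomorphisms between bounded above complexes. -/
def qis [HasZeroMorphisms 𝒜] [CategoryWithHomology 𝒜] : MorphismProperty (CMinus 𝒜) :=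
  (HomologicalComplex.quasiIso 𝒜 (ComplexShape.up ℤ)).inverseImage (boundedAbove 𝒜).ι

instance [HasZeroMorphisms 𝒜] [CategoryWithHomology 𝒜] : (qis 𝒜).IsMultiplicative := by
  dsimp [qis]
  infer_instance

/-- The derived category of bounded above complexes: the localization of the category of
bounded above complexes at the quasi-isomorphisms. -/
abbrev DMinus [HasZeroMorphisms 𝒜] [CategoryWithHomology 𝒜] := (qis 𝒜).Localization

end Complexes

section Tensor

theorem hasCoproduct_of_finite_support {𝒜 : Type*} [Category* 𝒜] [HasZeroMorphisms 𝒜]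
    [HasFiniteCoproducts 𝒜] {ι : Type*} (X : ι → 𝒜) (s : Set ι) (hs : s.Finite)
    (h : ∀ i, i ∉ s → IsZero (X i)) : HasCoproduct X := by
  classical
  have := hs.to_subtype
  refine HasColimit.mk ⟨Cofan.mk (∐ fun i : s => X i)
    (fun i => if hi : i ∈ s then Sigma.ι (fun i : s => X i) ⟨i, hi⟩ else 0),
    Cofan.IsColimit.mk _ (fun c => Limits.Sigma.desc (f := fun i : s => X i) fun i => c.inj i.1) ?_ ?_⟩
  · intro c i
    by_cases hi : i ∈ s
    · simp [hi]
    · exact (h i hi).eq_of_src _ _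
  · intro c m hm
    refine Limits.Sigma.hom_ext (f := fun i : s => X i) _ _ fun i => ?_
    have := hm i
    simpa using this

variable {𝒜 ℬ 𝒞 : Type*} [Category* 𝒜] [Category* ℬ] [Category* 𝒞]
  [Preadditive 𝒜] [Preadditive ℬ] [Preadditive 𝒞] [HasFiniteCoproducts 𝒞]
  (F : 𝒜 ⥤ ℬ ⥤ 𝒞) [F.Additive] [∀ X, (F.obj X).Additive]

theorem isZero_bifunctor_left {X : 𝒜} (hX : IsZero X) (Y : ℬ) : IsZero ((F.obj X).obj Y) :=
  Functor.map_isZero (F.flip.obj Y) hX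

instance hasMapBifunctor (K : CMinus 𝒜) (L : CMinus ℬ) :
    HomologicalComplex.HasMapBifunctor K.obj L.obj F (ComplexShape.up ℤ) := by
  obtain ⟨n, hn⟩ := K.property
  obtain ⟨m, hm⟩ := L.property
  intro j
  refine hasCoproduct_of_finite_support _ {p | p.1.1 ≤ n ∧ p.1.2 ≤ m} ?_ ?_
  · refine Set.Finite.of_injOn (f := fun p => p.1.1) (t := Set.Icc (j - m) n) ?_ ?_
      (Set.finite_Icc _ _)
    · rintro ⟨⟨a, b⟩, h⟩ ⟨h₁, h₂⟩
      change a + b = j at h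
      dsimp at h₁ h₂ ⊢
      constructor <;> lia
    · rintro ⟨⟨a, b⟩, h⟩ _ ⟨⟨a', b'⟩, h'⟩ _ hab
      change a + b = j at h
      change a' + b' = j at h'
      dsimp at hab
      ext <;> dsimp <;> lia
  · rintro ⟨⟨a, b⟩, h⟩ hab
    change IsZero ((F.obj (K.obj.X a)).obj (L.obj.X b))
    by_cases ha : a ≤ n
    · have hb : m < b := by
        by_contra hb
        exact hab ⟨ha, not_lt.1 hb⟩
      exact Functor.map_isZero _ (L.obj.isZero_of_isStrictlyLE m b hb)
    · exact isZero_bifunctor_left F (K.obj.isZero_of_isStrictlyLE n a (not_le.1 ha)) _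

theorem boundedAbove_mapBifunctor (K : CMinus 𝒜) (L : CMinus ℬ) :
    boundedAbove 𝒞 (HomologicalComplex.mapBifunctor K.obj L.obj F (ComplexShape.up ℤ)) := by
  obtain ⟨n, hn⟩ := K.property
  obtain ⟨m, hm⟩ := L.property
  refine ⟨n + m, (CochainComplex.isStrictlyLE_iff _ _).2 fun i hi => ?_⟩
  rw [IsZero.iff_id_eq_zero]
  refine HomologicalComplex.mapBifunctor.hom_ext fun a b h => ?_
  change a + b = i at h
  refine IsZero.eq_of_src ?_ _ _
  by_cases ha : a ≤ n
  · exact Functor.map_isZero _ (L.obj.isZero_of_isStrictlyLE m b (by lia))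
  · exact isZero_bifunctor_left F (K.obj.isZero_of_isStrictlyLE n a (not_le.1 ha)) _

/-- The bifunctor on bounded above complexes induced by a biadditive bifunctor `F`: it sends
`(K, L)` to the total complex with degree `n` part `⨁_{p + q = n} F (K p) (L q)` and
differential `F (d, 1) + (-1) ^ p F (1, d)`. -/
def mapBifunctorCMinus : CMinus 𝒜 ⥤ CMinus ℬ ⥤ CMinus 𝒞 where
  obj K :=
    { obj L := ⟨HomologicalComplex.mapBifunctor K.obj L.obj F (ComplexShape.up ℤ),
        boundedAbove_mapBifunctor F K L⟩
      map g := ObjectProperty.homMk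
        (HomologicalComplex.mapBifunctorMap (𝟙 K.obj) g.hom F (ComplexShape.up ℤ))
      map_id L := by
        refine ObjectProperty.hom_ext _ (HomologicalComplex.hom_ext _ _ fun i => ?_)
        exact HomologicalComplex.mapBifunctor.hom_ext fun a b h => by dsimp; simp
      map_comp f g := by
        refine ObjectProperty.hom_ext _ (HomologicalComplex.hom_ext _ _ fun i => ?_)
        exact HomologicalComplex.mapBifunctor.hom_ext fun a b h => by dsimp; simp }
  map f :=
    { app L := ObjectProperty.homMk
        (HomologicalComplex.mapBifunctorMap f.hom (𝟙 L.obj) F (ComplexShape.up ℤ))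
      naturality L L' g := by
        refine ObjectProperty.hom_ext _ (HomologicalComplex.hom_ext _ _ fun i => ?_)
        exact HomologicalComplex.mapBifunctor.hom_ext fun a b h => by dsimp; simp }
  map_id K := by
    ext L : 2
    refine ObjectProperty.hom_ext _ (HomologicalComplex.hom_ext _ _ fun i => ?_)
    exact HomologicalComplex.mapBifunctor.hom_ext fun a b h => by dsimp; simp
  map_comp f g := by
    ext L : 2
    refine ObjectProperty.hom_ext _ (HomologicalComplex.hom_ext _ _ fun i => ?_)
    exact HomologicalComplex.mapBifunctor.hom_ext fun a b h => by dsimp; simp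

end Tensor

section DerivedTensor

variable (k A B C : Type u) [Field k] [Ring A] [Algebra k A] [Ring B] [Algebra k B]
  [Ring C] [Algebra k C]
  [FiniteDimensional k A] [FiniteDimensional k B] [FiniteDimensional k C]

/-- The derived category `D⁻(A ⊗ Bᵒᵖ)` of bounded above complexes of finitely generated
`A`-`B`-bimodules. -/
abbrev DMinusBimod := DMinus (FGBimod k A B)

/-- The bifunctor `(L, M) ↦ L ⊗_B M` on bounded above complexes of bimodules, followed by the
passage to the derived category. -/
def tensorToDerived :
    CMinus (FGBimod k A B) × CMinus (FGBimod k B C) ⥤ DMinusBimod k A C :=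
  Functor.uncurry.obj (mapBifunctorCMinus (tensorBimod k A B C)) ⋙ (qis (FGBimod k A C)).Q

/-- The existence of a total left derived functor of `⊗_B` in both variables. -/
abbrev HasDerivedTensor : Prop :=
  (tensorToDerived k A B C).HasLeftDerivedFunctor
    ((qis (FGBimod k A B)).prod (qis (FGBimod k B C)))

/-- The derived tensor product `⊗ᴸ_B`, the total left derived functor of `⊗_B`, as a bifunctor
`D⁻(A ⊗ Bᵒᵖ) × D⁻(B ⊗ Cᵒᵖ) → D⁻(A ⊗ Cᵒᵖ)`. -/
def derivedTensor [HasDerivedTensor k A B C] :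
    DMinusBimod k A B ⥤ DMinusBimod k B C ⥤ DMinusBimod k A C :=
  Functor.curry.obj ((tensorToDerived k A B C).totalLeftDerived
    ((qis (FGBimod k A B)).Q.prod (qis (FGBimod k B C)).Q)
    ((qis (FGBimod k A B)).prod (qis (FGBimod k B C))))

end DerivedTensor

end DerivedTensor

end

/-! Choose a resolution P_B of B by finitely generated projective B-B-bimodules. The derived tensor
product is computed by L ⊗_B (P_B ⊗_B M): only the second factor is resolved, by tensoring with a
fixed complex.

Two one-sided facts make this work. A projective bimodule is projective on each side, so P_B has
right projective terms, and M ↦ P_B ⊗_B M preserves quasi-isomorphisms. Moreover X ⊗_B M is left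
projective when X is a projective bimodule (for X = B ⊗ Bᵒᵖ it is B ⊗_k M), so P_B ⊗_B M has left
projective terms and L ↦ L ⊗_B (P_B ⊗_B M) preserves quasi-isomorphisms. The augmentation P_B → B is
a quasi-isomorphism between bounded above complexes of right projective modules, so its cone is
contractible by right linear maps. Hence it stays a quasi-isomorphism after tensoring with any M,
and P_B ⊗_B M → M is a quasi-isomorphism. Statements about single modules pass to total complexes by
filtering by columns (`quasiIso_mapBifunctorMap_of_columns`).

Thus (L, M) ↦ (L, P_B ⊗_B M) is a functorial left deformation for ⊗_B, and a functor with such a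
deformation has a total left derived functor, computed on the deformed objects
(`isLeftDerivedFunctor_of_deformation`). The main check is `qis_map_right`: L ⊗_B - preserves
quasi-isomorphisms between complexes with left projective terms.

Associativity then already holds for complexes. The ordinary associator, used twice, gives (L ⊗ (P_B
⊗ M)) ⊗ (P_C ⊗ N) ≅ L ⊗ ((P_B ⊗ M) ⊗ (P_C ⊗ N)) ≅ L ⊗ (P_B ⊗ (M ⊗ (P_C ⊗ N))), naturally in L, M and
N (`resolvedTensorAssoc`). Both ends present the two iterated derived functors, so the isomorphism
descends to the localizations. -/

noncomputable section

namespace DerivedTensor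

/-! ### Quasi-isomorphisms on generalized elements -/

section QuasiIsoCriterion

variable {𝒞 : Type*} [Category* 𝒞] [Abelian 𝒞] {K L : CochainComplex 𝒞 ℤ}

/-- The vanishing, up to refinements, of the cohomology of the mapping cone of `φ`, spelled out
on generalized elements. -/
theorem quasiIso_iff_up_to_refinements (φ : K ⟶ L) :
    QuasiIso φ ↔ ∀ (i j l : ℤ) (_ : i + 1 = j) (_ : j + 1 = l) ⦃A : 𝒞⦄
      (x : A ⟶ K.X l) (y : A ⟶ L.X j) (_ : x ≫ K.d l (l + 1) = 0)
      (_ : x ≫ φ.f l = y ≫ L.d j l),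
      ∃ (A' : 𝒞) (π : A' ⟶ A) (_ : Epi π) (x' : A' ⟶ K.X j) (y' : A' ⟶ L.X i),
        π ≫ x = x' ≫ K.d j l ∧ π ≫ y = x' ≫ φ.f j + y' ≫ L.d i j := by
  have hprev : ∀ i j : ℤ, i + 1 = j → (ComplexShape.up ℤ).prev j = i := fun i j h =>
    (ComplexShape.up ℤ).prev_eq' h
  have hnext : ∀ i j : ℤ, i + 1 = j → (ComplexShape.up ℤ).next i = j := fun i j h =>
    (ComplexShape.up ℤ).next_eq' h
  constructor
  · intro hφ i j l hij hjl A x y hx hxy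
    have h₁ : Mono (HomologicalComplex.homologyMap φ l) := inferInstance
    have h₂ : Epi (HomologicalComplex.homologyMap φ j) := inferInstance
    rw [HomologicalComplex.mono_homologyMap_iff_up_to_refinements φ j l (l + 1)
      (hprev _ _ hjl) (hnext _ _ rfl)] at h₁
    rw [HomologicalComplex.epi_homologyMap_iff_up_to_refinements φ i j l
      (hprev _ _ hij) (hnext _ _ hjl)] at h₂
    obtain ⟨A₁, π₁, _, x₁, h⟩ := h₁ x hx y hxy
    -- Injectivity on cohomology in degree `l` makes `x` a coboundary of some `x₁`. Then `y` minus
    -- the image of `x₁` is a cocycle, and surjectivity in degree `j` applies to it.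
    obtain ⟨A₂, π₂, _, x₂, hx₂, y₂, h'⟩ := h₂ (π₁ ≫ y - x₁ ≫ φ.f j) (by
      simp only [Preadditive.sub_comp, Category.assoc, ← hxy, φ.comm, reassoc_of% h, sub_self])
    refine ⟨A₂, π₂ ≫ π₁, inferInstance, π₂ ≫ x₁ + x₂, y₂, ?_, ?_⟩
    · simp [h, hx₂]
    · rw [Preadditive.comp_sub] at h'
      rw [Category.assoc, eq_add_of_sub_eq h', Preadditive.add_comp, Category.assoc]
      abel
  · intro H
    rw [quasiIso_iff]
    intro j
    rw [quasiIsoAt_iff_isIso_homologyMap]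
    have : Mono (HomologicalComplex.homologyMap φ j) := by
      rw [HomologicalComplex.mono_homologyMap_iff_up_to_refinements φ (j - 1) j (j + 1)
        (hprev _ _ (by lia)) (hnext _ _ rfl)]
      intro A x hx y hxy
      obtain ⟨A', π, hπ, x', y', h, -⟩ := H (j - 2) (j - 1) j (by lia) (by lia) x y hx hxy
      exact ⟨A', π, hπ, x', h⟩
    have : Epi (HomologicalComplex.homologyMap φ j) := by
      rw [HomologicalComplex.epi_homologyMap_iff_up_to_refinements φ (j - 1) j (j + 1)
        (hprev _ _ (by lia)) (hnext _ _ rfl)]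
      intro A y hy
      -- A cocycle `y` of the target is the cone cocycle `(0, y)`.
      obtain ⟨A', π, hπ, x', y', h, h'⟩ := H (j - 1) j (j + 1) (by lia) (by lia)
        (0 : A ⟶ K.X (j + 1)) y (by simp) (by simp [hy])
      exact ⟨A', π, hπ, x', by simpa using h.symm, y', h'⟩
    exact isIso_of_mono_of_epi _

end QuasiIsoCriterion

/-! ### Total complexes as finite direct sums of their columns -/

section Components

variable {𝒜 ℬ 𝒞 : Type*} [Category* 𝒜] [Category* ℬ] [Category* 𝒞]
  [Preadditive 𝒜] [Preadditive ℬ] [Preadditive 𝒞] [HasFiniteCoproducts 𝒞]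
  (F : 𝒜 ⥤ ℬ ⥤ 𝒞) [F.Additive] [∀ X, (F.obj X).Additive]

open HomologicalComplex

/-- The component `F (K p) (L (n - p))` of the total complex in degree `n`. -/
def totalProj (K : CMinus 𝒜) (L : CMinus ℬ) (n p : ℤ) :
    (mapBifunctor K.obj L.obj F (ComplexShape.up ℤ)).X n ⟶
      (F.obj (K.obj.X p)).obj (L.obj.X (n - p)) :=
  mapBifunctorDesc fun i₁ i₂ h =>
    if e : i₁ = p then
      (F.map (K.obj.XIsoOfEq e).hom).app _ ≫
        (F.obj _).map (L.obj.XIsoOfEq (by change i₁ + i₂ = n at h; lia)).hom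
    else 0

/-- The inclusion of `F (K p) (L (n - p))` in the total complex in degree `n`. -/
abbrev totalIncl (K : CMinus 𝒜) (L : CMinus ℬ) (n p : ℤ) :
    (F.obj (K.obj.X p)).obj (L.obj.X (n - p)) ⟶
      (mapBifunctor K.obj L.obj F (ComplexShape.up ℤ)).X n :=
  ιMapBifunctor K.obj L.obj F (ComplexShape.up ℤ) p (n - p) n (by change p + (n - p) = n; lia)

variable {F}

theorem ι_totalProj (K : CMinus 𝒜) (L : CMinus ℬ) (n p q : ℤ) (h : p + q = n) :
    ιMapBifunctor K.obj L.obj F (ComplexShape.up ℤ) p q n h ≫ totalProj F K L n p =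
      (F.obj _).map (L.obj.XIsoOfEq (by lia)).hom := by
  simp [totalProj]

theorem ι_totalProj_of_ne (K : CMinus 𝒜) (L : CMinus ℬ) (n p p' q : ℤ) (h : p + q = n)
    (hp : p ≠ p') :
    ιMapBifunctor K.obj L.obj F (ComplexShape.up ℤ) p q n h ≫ totalProj F K L n p' = 0 := by
  simp [totalProj, hp]

theorem totalIncl_totalProj (K : CMinus 𝒜) (L : CMinus ℬ) (n p : ℤ) :
    totalIncl F K L n p ≫ totalProj F K L n p = 𝟙 _ := by
  rw [totalIncl, ι_totalProj]
  simp

/-- If `K` vanishes above `a` and `L` above `b`, only the columns `p` with `n - b ≤ p ≤ a` are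
nonzero in degree `n`, so the total complex is degreewise a finite biproduct. -/
theorem exists_sum_totalProj_totalIncl (K : CMinus 𝒜) (L : CMinus ℬ) (n : ℤ) :
    ∃ s : Finset ℤ, ∑ p ∈ s, totalProj F K L n p ≫ totalIncl F K L n p = 𝟙 _ := by
  obtain ⟨a, ha⟩ := K.property
  obtain ⟨b, hb⟩ := L.property
  refine ⟨Finset.Icc (n - b) a, mapBifunctor.hom_ext fun p q h => ?_⟩
  change p + q = n at h
  rw [Preadditive.comp_sum, Category.comp_id]
  by_cases hp : p ∈ Finset.Icc (n - b) a
  · rw [Finset.sum_eq_single_of_mem p hp]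
    · obtain rfl : q = n - p := by lia
      rw [← Category.assoc, ι_totalProj]
      simp
    · intro p' _ hp'
      rw [← Category.assoc, ι_totalProj_of_ne _ _ _ _ _ _ h hp'.symm, zero_comp]
  · refine IsZero.eq_of_src ?_ _ _
    rw [Finset.mem_Icc, not_and_or] at hp
    obtain hp | hp := hp
    · exact Functor.map_isZero _ (L.obj.isZero_of_isStrictlyLE b q (by lia))
    · exact isZero_bifunctor_left F (K.obj.isZero_of_isStrictlyLE a p (by lia)) _

theorem total_hom_ext {K : CMinus 𝒜} {L : CMinus ℬ} {n : ℤ} {A : 𝒞}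
    {f g : A ⟶ (mapBifunctor K.obj L.obj F (ComplexShape.up ℤ)).X n}
    (h : ∀ p, f ≫ totalProj F K L n p = g ≫ totalProj F K L n p) : f = g := by
  obtain ⟨s, hs⟩ := exists_sum_totalProj_totalIncl (F := F) K L n
  rw [← Category.comp_id f, ← Category.comp_id g, ← hs, Preadditive.comp_sum, Preadditive.comp_sum]
  exact Finset.sum_congr rfl fun p _ => by rw [← Category.assoc, h, Category.assoc]

theorem map_totalProj (K : CMinus 𝒜) {L L' : CMinus ℬ} (f : L ⟶ L') (n p : ℤ) :
    (mapBifunctorMap (𝟙 K.obj) f.hom F (ComplexShape.up ℤ)).f n ≫ totalProj F K L' n p =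
      totalProj F K L n p ≫ (F.obj (K.obj.X p)).map (f.hom.f (n - p)) := by
  refine mapBifunctor.hom_ext fun i₁ i₂ h => ?_
  change i₁ + i₂ = n at h
  rw [ι_mapBifunctorMap_assoc]
  by_cases hp : i₁ = p
  · subst hp
    obtain rfl : i₂ = n - i₁ := by lia
    rw [ι_totalProj, ← Category.assoc (ιMapBifunctor _ _ _ _ _ _ _ _), ι_totalProj]
    simp
  · rw [ι_totalProj_of_ne _ _ _ _ _ _ h hp, ← Category.assoc (ιMapBifunctor _ _ _ _ _ _ _ _),
      ι_totalProj_of_ne _ _ _ _ _ _ h hp]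
    simp

/-- Column `p` receives only the horizontal differential from column `p - 1` and the vertical one,
with sign (-1)^p, from column `p`. So the differential never lowers the column index, which is what
the induction on columns needs. -/
theorem d_totalProj (K : CMinus 𝒜) (L : CMinus ℬ) (n n' p : ℤ) (hn : n + 1 = n') :
    (mapBifunctor K.obj L.obj F (ComplexShape.up ℤ)).d n n' ≫ totalProj F K L n' p =
      totalProj F K L n (p - 1) ≫ (F.map (K.obj.d (p - 1) p)).app _ ≫
          (F.obj _).map (L.obj.XIsoOfEq (by lia)).hom +
        p.negOnePow • totalProj F K L n p ≫ (F.obj (K.obj.X p)).map (L.obj.d (n - p) (n' - p)) := by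
  refine mapBifunctor.hom_ext fun i₁ i₂ h => ?_
  change i₁ + i₂ = n at h
  rw [mapBifunctor.d_eq, Preadditive.add_comp, Preadditive.comp_add, mapBifunctor.ι_D₁_assoc,
    mapBifunctor.ι_D₂_assoc, Preadditive.comp_add, Linear.comp_units_smul]
  congr 1
  · by_cases hp : i₁ = p - 1
    · subst hp
      obtain rfl : i₂ = n - (p - 1) := by lia
      rw [← Category.assoc (ιMapBifunctor _ _ _ _ _ _ _ _), ι_totalProj,
        mapBifunctor.d₁_eq _ _ _ _ (show (ComplexShape.up ℤ).Rel (p - 1) p by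
          change p - 1 + 1 = p; lia) _ _ (show p + (n - (p - 1)) = n' by lia),
        Linear.units_smul_comp, Category.assoc, ι_totalProj]
      -- The sign of the horizontal differential is 1 by definition.
      trans (1 : ℤˣ) • ((F.map (K.obj.d (p - 1) p)).app (L.obj.X (n - (p - 1))) ≫
        (F.obj (K.obj.X p)).map (L.obj.XIsoOfEq (by lia)).hom)
      · rfl
      · simp
    · rw [mapBifunctor.d₁_eq _ _ _ _ (show (ComplexShape.up ℤ).Rel i₁ (i₁ + 1) from rfl) _ _
          (show i₁ + 1 + i₂ = n' by lia), Linear.units_smul_comp, Category.assoc,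
        ι_totalProj_of_ne _ _ _ _ _ _ _ (by lia), ← Category.assoc (ιMapBifunctor _ _ _ _ _ _ _ _),
        ι_totalProj_of_ne _ _ _ _ _ _ h hp]
      simp
  · by_cases hp : i₁ = p
    · subst hp
      obtain rfl : i₂ = n - i₁ := by lia
      rw [← Category.assoc (ιMapBifunctor _ _ _ _ _ _ _ _), ι_totalProj,
        mapBifunctor.d₂_eq _ _ _ _ _ (show (ComplexShape.up ℤ).Rel (n - i₁) (n' - i₁) by
          change n - i₁ + 1 = n' - i₁; lia) _ (show i₁ + (n' - i₁) = n' by lia),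
        Linear.units_smul_comp, Category.assoc, ι_totalProj]
      trans i₁.negOnePow • ((F.obj (K.obj.X i₁)).map (L.obj.d (n - i₁) (n' - i₁)) ≫
        (F.obj (K.obj.X i₁)).map (L.obj.XIsoOfEq rfl).hom)
      · rfl
      · simp
    · rw [mapBifunctor.d₂_eq _ _ _ _ _ (show (ComplexShape.up ℤ).Rel i₂ (i₂ + 1) from rfl) _
          (show i₁ + (i₂ + 1) = n' by lia), Linear.units_smul_comp, Category.assoc,
        ι_totalProj_of_ne _ _ _ _ _ _ _ hp, ← Category.assoc (ιMapBifunctor _ _ _ _ _ _ _ _),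
        ι_totalProj_of_ne _ _ _ _ _ _ h hp]
      simp

theorem totalIncl_d_totalProj (K : CMinus 𝒜) (L : CMinus ℬ) (n n' p : ℤ) (hn : n + 1 = n') :
    totalIncl F K L n p ≫ (mapBifunctor K.obj L.obj F (ComplexShape.up ℤ)).d n n' ≫
      totalProj F K L n' p =
      p.negOnePow • (F.obj (K.obj.X p)).map (L.obj.d (n - p) (n' - p)) := by
  rw [d_totalProj _ _ _ _ _ hn, Preadditive.comp_add, ← Category.assoc (totalIncl F K L n p),
    ι_totalProj_of_ne _ _ _ _ _ _ _ (by lia), zero_comp, zero_add, Linear.comp_units_smul,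
    ← Category.assoc, totalIncl_totalProj, Category.id_comp]

theorem totalIncl_d_totalProj_of_lt (K : CMinus 𝒜) (L : CMinus ℬ) (n n' p p' : ℤ)
    (hn : n + 1 = n') (hp : p' < p) :
    totalIncl F K L n p ≫ (mapBifunctor K.obj L.obj F (ComplexShape.up ℤ)).d n n' ≫
      totalProj F K L n' p' = 0 := by
  rw [d_totalProj _ _ _ _ _ hn, Preadditive.comp_add, ← Category.assoc (totalIncl F K L n p),
    ι_totalProj_of_ne _ _ _ _ _ _ _ (by lia), zero_comp, zero_add, Linear.comp_units_smul,
    ← Category.assoc, ι_totalProj_of_ne _ _ _ _ _ _ _ (by lia), zero_comp, smul_zero]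

end Components

/-! ### Columnwise quasi-isomorphisms induce quasi-isomorphisms of total complexes -/

section TotalQuasiIso

open HomologicalComplex

variable {𝒜 ℬ 𝒞 : Type*} [Category* 𝒜] [Category* ℬ] [Category* 𝒞]
  [Preadditive 𝒜] [Preadditive ℬ] [Abelian 𝒞]
  (F : 𝒜 ⥤ ℬ ⥤ 𝒞) [F.Additive] [∀ X, (F.obj X).Additive]

/-- A morphism of bounded above double complexes which is a quasi-isomorphism on each column
induces a quasi-isomorphism on total complexes. -/
theorem quasiIso_mapBifunctorMap_of_columns (K : CMinus 𝒜) {L L' : CMinus ℬ} (f : L ⟶ L')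
    (hf : ∀ p, QuasiIso (((F.obj (K.obj.X p)).mapHomologicalComplex (ComplexShape.up ℤ)).map f.hom)) :
    QuasiIso (mapBifunctorMap (𝟙 K.obj) f.hom F (ComplexShape.up ℤ)) := by
  rw [quasiIso_iff_up_to_refinements]
  intro i j l hij hjl
  obtain ⟨N, hN⟩ := K.property
  -- Cone cocycles `(x, y)` are shown to bound, by induction on the number `r` of columns in which
  -- they may live: those from `N + 1 - r` to `N`. Columns above `N` are zero.
  suffices H : ∀ (r : ℕ) ⦃A : 𝒞⦄
      (x : A ⟶ (mapBifunctor K.obj L.obj F (ComplexShape.up ℤ)).X l)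
      (y : A ⟶ (mapBifunctor K.obj L'.obj F (ComplexShape.up ℤ)).X j)
      (_ : x ≫ (mapBifunctor K.obj L.obj F (ComplexShape.up ℤ)).d l (l + 1) = 0)
      (_ : x ≫ (mapBifunctorMap (𝟙 K.obj) f.hom F (ComplexShape.up ℤ)).f l =
        y ≫ (mapBifunctor K.obj L'.obj F (ComplexShape.up ℤ)).d j l)
      (_ : ∀ p < N + 1 - r, x ≫ totalProj F K L l p = 0 ∧ y ≫ totalProj F K L' j p = 0),
      ∃ (A' : 𝒞) (π : A' ⟶ A) (_ : Epi π)
        (x' : A' ⟶ (mapBifunctor K.obj L.obj F (ComplexShape.up ℤ)).X j)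
        (y' : A' ⟶ (mapBifunctor K.obj L'.obj F (ComplexShape.up ℤ)).X i),
        π ≫ x = x' ≫ (mapBifunctor K.obj L.obj F (ComplexShape.up ℤ)).d j l ∧
        π ≫ y = x' ≫ (mapBifunctorMap (𝟙 K.obj) f.hom F (ComplexShape.up ℤ)).f j +
          y' ≫ (mapBifunctor K.obj L'.obj F (ComplexShape.up ℤ)).d i j by
    intro A x y hx hxy
    obtain ⟨b, hb⟩ := L.property
    obtain ⟨b', hb'⟩ := L'.property
    -- In columns `p < l - b` the second index `l - p` exceeds the bound `b` of `L`, and similarly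
    -- for `L'`. Hence every pair is supported in finitely many columns.
    refine H (N + 1 - min (l - b) (j - b')).toNat x y hx hxy fun p hp => ⟨?_, ?_⟩
    · exact (Functor.map_isZero _ (L.obj.isZero_of_isStrictlyLE b _ (by lia))).eq_of_tgt _ _
    · exact (Functor.map_isZero _ (L'.obj.isZero_of_isStrictlyLE b' _ (by lia))).eq_of_tgt _ _
  intro r
  induction r with
  | zero =>
    intro A x y _ _ h
    have h' : ∀ p, N < p → IsZero (K.obj.X p) := fun p hp => K.obj.isZero_of_isStrictlyLE N p hp
    refine ⟨A, 𝟙 A, inferInstance, 0, 0, ?_, ?_⟩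
    · rw [zero_comp, Category.id_comp]
      refine total_hom_ext fun p => ?_
      rw [zero_comp]
      by_cases hp : p ≤ N
      · exact (h p (by simp; lia)).1
      · exact (isZero_bifunctor_left F (h' p (by lia)) _).eq_of_tgt _ _
    · rw [zero_comp, zero_comp, add_zero, Category.id_comp]
      refine total_hom_ext fun p => ?_
      rw [zero_comp]
      by_cases hp : p ≤ N
      · exact (h p (by simp; lia)).2
      · exact (isZero_bifunctor_left F (h' p (by lia)) _).eq_of_tgt _ _
  | succ r ih =>
    intro A x y hx hxy h
    -- The lowest column in which the pair may be nonzero. Since nothing arrives from column `p -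
    -- 1`, the components there form a cocycle of the cone of the column map, once `y` is twisted by
    -- the sign (-1)^p of the vertical differential.
    set p := N - r with hp
    have hlow : ∀ p' < p, x ≫ totalProj F K L l p' = 0 ∧ y ≫ totalProj F K L' j p' = 0 :=
      fun p' hp' => h p' (by push_cast; lia)
    have hsq : p.negOnePow * p.negOnePow = 1 := Int.units_mul_self _
    have hx₀ : (x ≫ totalProj F K L l p) ≫
        (F.obj (K.obj.X p)).map (L.obj.d (l - p) (l - p + 1)) = 0 := by
      have := congr($hx ≫ totalProj F K L (l + 1) p)
      rw [Category.assoc, d_totalProj _ _ _ _ _ rfl, zero_comp, Preadditive.comp_add,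
        ← Category.assoc, (hlow (p - 1) (by lia)).1, zero_comp, zero_add,
        Linear.comp_units_smul, smul_eq_zero_iff_eq] at this
      rw [Category.assoc]
      have e : l + 1 - p = l - p + 1 := by lia
      rwa [e] at this
    have hxy₀ : (x ≫ totalProj F K L l p) ≫ (F.obj (K.obj.X p)).map (f.hom.f (l - p)) =
        (p.negOnePow • y ≫ totalProj F K L' j p) ≫
          (F.obj (K.obj.X p)).map (L'.obj.d (j - p) (l - p)) := by
      have := congr($hxy ≫ totalProj F K L' l p)
      rw [Category.assoc, Category.assoc, d_totalProj _ _ _ _ _ hjl, map_totalProj,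
        Preadditive.comp_add, ← Category.assoc y, (hlow (p - 1) (by lia)).2, zero_comp, zero_add,
        Linear.comp_units_smul] at this
      rw [Category.assoc, this, Linear.units_smul_comp, Category.assoc]
    obtain ⟨A₁, π₁, _, x₁, y₁, h₁, h₁'⟩ :=
      (quasiIso_iff_up_to_refinements _).1 (hf p) (i - p) (j - p) (l - p) (by lia) (by lia)
        (x ≫ totalProj F K L l p) (p.negOnePow • y ≫ totalProj F K L' j p) hx₀ hxy₀
    change A₁ ⟶ (F.obj (K.obj.X p)).obj (L.obj.X (j - p)) at x₁
    change A₁ ⟶ (F.obj (K.obj.X p)).obj (L'.obj.X (i - p)) at y₁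
    change π₁ ≫ x ≫ totalProj F K L l p =
      x₁ ≫ (F.obj (K.obj.X p)).map (L.obj.d (j - p) (l - p)) at h₁
    change π₁ ≫ (p.negOnePow • y ≫ totalProj F K L' j p) = x₁ ≫ (F.obj (K.obj.X p)).map (f.hom.f (j - p)) +
      y₁ ≫ (F.obj (K.obj.X p)).map (L'.obj.d (i - p) (j - p)) at h₁'
    -- The column primitive, placed in the total complex. The sign on `x₁` cancels that of the
    -- vertical differential; `y₁` needs none, because its differential acquires the same sign
    -- (-1)^p.
    let X₁ := (p.negOnePow • x₁) ≫ totalIncl F K L j p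
    let Y₁ := y₁ ≫ totalIncl F K L' i p
    -- Subtracting the cone coboundary of `(X₁, Y₁)` kills column `p` and creates nothing in lower
    -- columns, so the induction hypothesis applies.
    obtain ⟨A₂, π₂, _, x₂, y₂, h₂, h₂'⟩ := ih
      (π₁ ≫ x - X₁ ≫ (mapBifunctor K.obj L.obj F (ComplexShape.up ℤ)).d j l)
      (π₁ ≫ y - X₁ ≫ (mapBifunctorMap (𝟙 K.obj) f.hom F (ComplexShape.up ℤ)).f j -
        Y₁ ≫ (mapBifunctor K.obj L'.obj F (ComplexShape.up ℤ)).d i j) (by simp [hx]) (by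
          simp [hxy, Preadditive.sub_comp]) (by
        intro p' hp'
        obtain hp' | rfl : p' < p ∨ p' = p := by lia
        · constructor
          · rw [Preadditive.sub_comp, Category.assoc, (hlow _ hp').1, comp_zero, zero_sub,
              neg_eq_zero, Category.assoc, Category.assoc,
              totalIncl_d_totalProj_of_lt _ _ _ _ _ _ hjl hp', comp_zero]
          · rw [Preadditive.sub_comp, Preadditive.sub_comp, Category.assoc, (hlow _ hp').2,
              comp_zero, Category.assoc, Category.assoc, Category.assoc, Category.assoc,
              totalIncl_d_totalProj_of_lt _ _ _ _ _ _ hij hp', map_totalProj,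
              ← Category.assoc (totalIncl F K L j p), ι_totalProj_of_ne _ _ _ _ _ _ _ hp'.ne']
            simp
        · constructor
          · rw [Preadditive.sub_comp, Category.assoc, Category.assoc, Category.assoc,
              totalIncl_d_totalProj _ _ _ _ _ hjl, h₁, Linear.comp_units_smul,
              Linear.units_smul_comp, smul_smul, hsq, one_smul, sub_self]
          · rw [Preadditive.sub_comp, Preadditive.sub_comp, Category.assoc, Category.assoc,
              Category.assoc, Category.assoc, Category.assoc,
              totalIncl_d_totalProj _ _ _ _ _ hij, map_totalProj,
              ← Category.assoc (totalIncl F K L j p), totalIncl_totalProj, Category.id_comp,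
              Linear.comp_units_smul, Linear.units_smul_comp, sub_sub, ← smul_add, ← h₁',
              Linear.comp_units_smul, smul_smul, hsq, one_smul, sub_self])
    refine ⟨A₂, π₂ ≫ π₁, inferInstance, π₂ ≫ X₁ + x₂, π₂ ≫ Y₁ + y₂, ?_, ?_⟩
    · rw [Preadditive.comp_sub] at h₂
      rw [Category.assoc, eq_add_of_sub_eq h₂, Preadditive.add_comp]
      simp only [X₁, Category.assoc]
      abel
    · rw [Preadditive.comp_sub, Preadditive.comp_sub] at h₂'
      rw [Category.assoc, eq_add_of_sub_eq (eq_add_of_sub_eq h₂'), Preadditive.add_comp,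
        Preadditive.add_comp]
      simp only [X₁, Y₁, Category.assoc]
      abel

instance (X : ℬ) : (F.flip.obj X).Additive where
  map_add := by intros; simp

instance : F.flip.Additive where
  map_add := by intros; ext; simp

/-- A morphism of bounded above double complexes which is a quasi-isomorphism on each row
induces a quasi-isomorphism on total complexes. -/
theorem quasiIso_mapBifunctorMap_of_rows {K K' : CMinus 𝒜} (f : K ⟶ K') (L : CMinus ℬ)
    (hf : ∀ q, QuasiIso
      (((F.flip.obj (L.obj.X q)).mapHomologicalComplex (ComplexShape.up ℤ)).map f.hom)) :
    QuasiIso (mapBifunctorMap f.hom (𝟙 L.obj) F (ComplexShape.up ℤ)) := by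
  have := quasiIso_mapBifunctorMap_of_columns F.flip L f hf
  have e := mapBifunctorFlipIso_hom_naturality f.hom (𝟙 L.obj) F (ComplexShape.up ℤ)
  have h : QuasiIso ((mapBifunctorFlipIso K.obj L.obj F (ComplexShape.up ℤ)).hom ≫
      mapBifunctorMap f.hom (𝟙 L.obj) F (ComplexShape.up ℤ)) := by
    rw [← e]
    infer_instance
  exact quasiIso_of_comp_left (mapBifunctorFlipIso K.obj L.obj F (ComplexShape.up ℤ)).hom _

end TotalQuasiIso

/-! ### Additive functors and essentially finite coproducts -/

section FiniteSupport

variable {𝒜 ℬ : Type*} [Category* 𝒜] [Category* ℬ] [Preadditive 𝒜] [Preadditive ℬ]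

/-- Additive functors preserve coproducts with finitely many nonzero terms. -/
theorem preservesColimit_of_finite_support (H : 𝒜 ⥤ ℬ) [H.Additive] {ι : Type*} (X : ι → 𝒜)
    (s : Set ι) (hs : s.Finite) (h : ∀ i, i ∉ s → IsZero (X i)) :
    PreservesColimit (Discrete.functor X) H := by
  classical
  refine ⟨fun {c} hc => ⟨?_⟩⟩
  let δ (i j : ι) : X j ⟶ X i := if e : j = i then eqToHom (by rw [e]) else 0
  let π (i : ι) : c.pt ⟶ X i := hc.desc (Cofan.mk (X i) (δ i))
  have hπ (i j : ι) : c.ι.app ⟨j⟩ ≫ π i = δ i j := hc.fac _ _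
  have hδ (i : ι) : δ i i = 𝟙 _ := by simp [δ]
  have hδ' (i j : ι) (hij : j ≠ i) : δ i j = 0 := by simp [δ, hij]
  -- The biproduct identity: it involves only finite sums and compositions, hence survives under `H`
  -- and characterizes the coproduct there.
  have hsum : ∑ i ∈ hs.toFinset, π i ≫ c.ι.app ⟨i⟩ = 𝟙 _ := by
    refine hc.hom_ext fun ⟨j⟩ => ?_
    rw [Preadditive.comp_sum, Category.comp_id]
    by_cases hj : j ∈ s
    · rw [Finset.sum_eq_single_of_mem j (by simpa using hj)]
      · rw [← Category.assoc, hπ, hδ]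
        exact Category.id_comp _
      · intro i _ hi
        rw [← Category.assoc, hπ, hδ' _ _ hi.symm, zero_comp]
    · exact (h j hj).eq_of_src _ _
  refine
    { desc := fun t => ∑ i ∈ hs.toFinset, H.map (π i) ≫ t.ι.app ⟨i⟩
      fac := ?_
      uniq := ?_ }
  · rintro t ⟨j⟩
    rw [Preadditive.comp_sum]
    by_cases hj : j ∈ s
    · rw [Finset.sum_eq_single_of_mem j (by simpa using hj)]
      · rw [← Category.assoc, Functor.mapCocone_ι_app, ← H.map_comp, hπ, hδ]
        exact (congr($(H.map_id (X j)) ≫ _)).trans (Category.id_comp _)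
      · intro i _ hi
        rw [← Category.assoc, Functor.mapCocone_ι_app, ← H.map_comp, hπ, hδ' _ _ hi.symm,
          H.map_zero, zero_comp]
    · exact (H.map_isZero (h j hj)).eq_of_src _ _
  · intro t m hm
    have : m = H.map (𝟙 c.pt) ≫ m := by rw [H.map_id]; exact (Category.id_comp _).symm
    rw [this, ← hsum, H.map_sum, Preadditive.sum_comp]
    refine Finset.sum_congr rfl fun i _ => ?_
    rw [H.map_comp, Category.assoc]
    exact congr(_ ≫ $(hm ⟨i⟩))

end FiniteSupport

/-! ### Naturality of an associator in three variables -/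

section TrifunctorComponents

variable {C₁ C₂ C₃ C₁₂ C₂₃ C₄ : Type*} [Category* C₁] [Category* C₂] [Category* C₃]
  [Category* C₁₂] [Category* C₂₃] [Category* C₄]
  {F₁₂ : C₁ ⥤ C₂ ⥤ C₁₂} {G : C₁₂ ⥤ C₃ ⥤ C₄} {F : C₁ ⥤ C₂₃ ⥤ C₄} {G₂₃ : C₂ ⥤ C₃ ⥤ C₂₃}

/-- The components of an isomorphism `bifunctorComp₁₂ F₁₂ G ≅ bifunctorComp₂₃ F G₂₃`. -/
abbrev trifunctorComponent (a : bifunctorComp₁₂ F₁₂ G ≅ bifunctorComp₂₃ F G₂₃)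
    (X₁ : C₁) (X₂ : C₂) (X₃ : C₃) :
    (G.obj ((F₁₂.obj X₁).obj X₂)).obj X₃ ⟶ (F.obj X₁).obj ((G₂₃.obj X₂).obj X₃) :=
  ((a.hom.app X₁).app X₂).app X₃

theorem trifunctorComponent_naturality (a : bifunctorComp₁₂ F₁₂ G ≅ bifunctorComp₂₃ F G₂₃)
    {X₁ X₁' : C₁} {X₂ X₂' : C₂} {X₃ X₃' : C₃} (f₁ : X₁ ⟶ X₁') (f₂ : X₂ ⟶ X₂') (f₃ : X₃ ⟶ X₃') :
    (G.map ((F₁₂.map f₁).app X₂ ≫ (F₁₂.obj X₁').map f₂)).app X₃ ≫ (G.obj _).map f₃ ≫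
        trifunctorComponent a X₁' X₂' X₃' =
      trifunctorComponent a X₁ X₂ X₃ ≫ (F.map f₁).app _ ≫
        (F.obj X₁').map ((G₂₃.map f₂).app X₃ ≫ (G₂₃.obj X₂').map f₃) := by
  have n₁ : (G.map ((F₁₂.map f₁).app X₂)).app X₃ ≫ trifunctorComponent a X₁' X₂ X₃ =
      trifunctorComponent a X₁ X₂ X₃ ≫ (F.map f₁).app _ :=
    NatTrans.naturality_app_app a.hom f₁ X₂ X₃
  have n₂ : (G.map ((F₁₂.obj X₁').map f₂)).app X₃ ≫ trifunctorComponent a X₁' X₂' X₃ =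
      trifunctorComponent a X₁' X₂ X₃ ≫ (F.obj X₁').map ((G₂₃.map f₂).app X₃) :=
    NatTrans.naturality_app (a.hom.app X₁') X₃ f₂
  have n₃ : (G.obj ((F₁₂.obj X₁').obj X₂')).map f₃ ≫ trifunctorComponent a X₁' X₂' X₃' =
      trifunctorComponent a X₁' X₂' X₃ ≫ (F.obj X₁').map ((G₂₃.obj X₂').map f₃) :=
    NatTrans.naturality ((a.hom.app X₁').app X₂') f₃
  rw [n₃, Functor.map_comp, NatTrans.comp_app, Functor.map_comp, Category.assoc,
    reassoc_of% n₂, reassoc_of% n₁]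

end TrifunctorComponents

/-! ### The associator for bounded above complexes -/

section Associator

open HomologicalComplex

variable {C₁ C₂ C₃ C₁₂ C₂₃ C₄ : Type*} [Category* C₁] [Category* C₂] [Category* C₃]
  [Category* C₁₂] [Category* C₂₃] [Category* C₄]
  [Preadditive C₁] [Preadditive C₂] [Preadditive C₃]
  [Preadditive C₁₂] [Preadditive C₂₃] [Preadditive C₄]
  [HasFiniteCoproducts C₁₂] [HasFiniteCoproducts C₂₃] [HasFiniteCoproducts C₄]
  {F₁₂ : C₁ ⥤ C₂ ⥤ C₁₂} {G : C₁₂ ⥤ C₃ ⥤ C₄} {F : C₁ ⥤ C₂₃ ⥤ C₄} {G₂₃ : C₂ ⥤ C₃ ⥤ C₂₃}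
  [F₁₂.Additive] [∀ X, (F₁₂.obj X).Additive] [G.Additive] [∀ X, (G.obj X).Additive]
  [F.Additive] [∀ X, (F.obj X).Additive] [G₂₃.Additive] [∀ X, (G₂₃.obj X).Additive]

theorem finite_support_bifunctor {𝒜 ℬ 𝒞 : Type*} [Category* 𝒜] [Category* ℬ] [Category* 𝒞]
    [Preadditive 𝒜] [Preadditive ℬ] [Preadditive 𝒞] [HasFiniteCoproducts 𝒞]
    (F : 𝒜 ⥤ ℬ ⥤ 𝒞) [F.Additive] [∀ X, (F.obj X).Additive] (K : CMinus 𝒜) (L : CMinus ℬ) (n : ℤ) :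
    ∃ s : Set (ComplexShape.π (ComplexShape.up ℤ) (ComplexShape.up ℤ) (ComplexShape.up ℤ) ⁻¹' {n}),
      s.Finite ∧ ∀ i, i ∉ s → IsZero ((F.obj (K.obj.X i.1.1)).obj (L.obj.X i.1.2)) := by
  obtain ⟨a, ha⟩ := K.property
  obtain ⟨b, hb⟩ := L.property
  refine ⟨{i | i.1.1 ≤ a ∧ i.1.2 ≤ b}, ?_, ?_⟩
  · refine Set.Finite.of_injOn (f := fun p => p.1.1) (t := Set.Icc (n - b) a) ?_ ?_
      (Set.finite_Icc _ _)
    · rintro ⟨⟨p, q⟩, h⟩ ⟨h₁, h₂⟩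
      change p + q = n at h
      dsimp at h₁ h₂ ⊢
      constructor <;> lia
    · rintro ⟨⟨p, q⟩, h⟩ _ ⟨⟨p', q'⟩, h'⟩ _ hp
      change p + q = n at h
      change p' + q' = n at h'
      dsimp at hp
      ext <;> dsimp <;> lia
  · rintro ⟨⟨p, q⟩, h⟩ hpq
    by_cases hp : p ≤ a
    · exact Functor.map_isZero _ (L.obj.isZero_of_isStrictlyLE b q
        (not_le.1 fun hq => hpq ⟨hp, hq⟩))
    · exact isZero_bifunctor_left F (K.obj.isZero_of_isStrictlyLE a p (not_le.1 hp)) _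

/-- Forming iterated total complexes requires `G (-, Z)` to commute with the coproducts that build
the inner one. Boundedness leaves only finitely many nonzero terms, so additivity is enough. -/
instance hasGoodTrifunctor₁₂ (K₁ : CMinus C₁) (K₂ : CMinus C₂) (K₃ : CMinus C₃) :
    HasGoodTrifunctor₁₂Obj F₁₂ G K₁.obj K₂.obj K₃.obj (ComplexShape.up ℤ) (ComplexShape.up ℤ) := by
  intro n i₃
  obtain ⟨s, hs, h⟩ := finite_support_bifunctor F₁₂ K₁ K₂ n
  have : (G.flip.obj (K₃.obj.X i₃)).Additive := ⟨by intros; simp⟩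
  exact preservesColimit_of_finite_support _ _ s hs h

instance hasGoodTrifunctor₂₃ (K₁ : CMinus C₁) (K₂ : CMinus C₂) (K₃ : CMinus C₃) :
    HasGoodTrifunctor₂₃Obj F G₂₃ K₁.obj K₂.obj K₃.obj (ComplexShape.up ℤ) (ComplexShape.up ℤ)
      (ComplexShape.up ℤ) := by
  intro i₁ n
  obtain ⟨s, hs, h⟩ := finite_support_bifunctor G₂₃ K₂ K₃ n
  exact preservesColimit_of_finite_support _ _ s hs h

instance hasMapBifunctor_mapBifunctor_left (K₁ : CMinus C₁) (K₂ : CMinus C₂) (K₃ : CMinus C₃) :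
    HasMapBifunctor (mapBifunctor K₁.obj K₂.obj F₁₂ (ComplexShape.up ℤ)) K₃.obj G
      (ComplexShape.up ℤ) :=
  hasMapBifunctor G (((mapBifunctorCMinus F₁₂).obj K₁).obj K₂) K₃

instance hasMapBifunctor_mapBifunctor_right (K₁ : CMinus C₁) (K₂ : CMinus C₂) (K₃ : CMinus C₃) :
    HasMapBifunctor K₁.obj (mapBifunctor K₂.obj K₃.obj G₂₃ (ComplexShape.up ℤ)) F
      (ComplexShape.up ℤ) :=
  hasMapBifunctor F K₁ (((mapBifunctorCMinus G₂₃).obj K₂).obj K₃)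

/-- The associativity isomorphism for three bounded above complexes. -/
def associatorCMinusApp (a : bifunctorComp₁₂ F₁₂ G ≅ bifunctorComp₂₃ F G₂₃)
    (K₁ : CMinus C₁) (K₂ : CMinus C₂) (K₃ : CMinus C₃) :
    ((mapBifunctorCMinus G).obj (((mapBifunctorCMinus F₁₂).obj K₁).obj K₂)).obj K₃ ≅
      ((mapBifunctorCMinus F).obj K₁).obj (((mapBifunctorCMinus G₂₃).obj K₂).obj K₃) :=
  (boundedAbove C₄).isoMk (mapBifunctorAssociator a K₁.obj K₂.obj K₃.obj (ComplexShape.up ℤ)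
    (ComplexShape.up ℤ) (ComplexShape.up ℤ))

/-- The inclusion of a triple summand is a composite of two inclusions for bifunctors; naturality is
applied to each of them. -/
theorem ι_mapBifunctorMap₁₂ {K₁ K₁' : CMinus C₁} {K₂ K₂' : CMinus C₂} {K₃ K₃' : CMinus C₃}
    (f₁ : K₁.obj ⟶ K₁'.obj) (f₂ : K₂.obj ⟶ K₂'.obj) (f₃ : K₃.obj ⟶ K₃'.obj)
    (i₁ i₂ i₃ j : ℤ)
    (h : ComplexShape.r (ComplexShape.up ℤ) (ComplexShape.up ℤ) (ComplexShape.up ℤ)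
      (ComplexShape.up ℤ) (ComplexShape.up ℤ) (i₁, i₂, i₃) = j) :
    mapBifunctor₁₂.ι F₁₂ G K₁.obj K₂.obj K₃.obj (ComplexShape.up ℤ) (ComplexShape.up ℤ)
        i₁ i₂ i₃ j h ≫
      (mapBifunctorMap (mapBifunctorMap f₁ f₂ F₁₂ (ComplexShape.up ℤ)) f₃ G
        (ComplexShape.up ℤ)).f j =
    (G.map ((F₁₂.map (f₁.f i₁)).app (K₂.obj.X i₂) ≫ (F₁₂.obj (K₁'.obj.X i₁)).map (f₂.f i₂))).app
        (K₃.obj.X i₃) ≫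
      (G.obj ((F₁₂.obj (K₁'.obj.X i₁)).obj (K₂'.obj.X i₂))).map (f₃.f i₃) ≫
      mapBifunctor₁₂.ι F₁₂ G K₁'.obj K₂'.obj K₃'.obj (ComplexShape.up ℤ) (ComplexShape.up ℤ)
        i₁ i₂ i₃ j h := by
  have h' : ComplexShape.π (ComplexShape.up ℤ) (ComplexShape.up ℤ) (ComplexShape.up ℤ)
    (ComplexShape.π (ComplexShape.up ℤ) (ComplexShape.up ℤ) (ComplexShape.up ℤ) (i₁, i₂), i₃) = j :=
    h
  rw [mapBifunctor₁₂.ι_eq _ _ _ _ _ _ _ _ _ _ _ _ rfl h',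
    mapBifunctor₁₂.ι_eq _ _ _ _ _ _ _ _ _ _ _ _ rfl h', Category.assoc, ι_mapBifunctorMap,
    ← NatTrans.comp_app_assoc, ← G.map_comp, ι_mapBifunctorMap, NatTrans.naturality_assoc]
  simp

theorem ι_mapBifunctorMap₂₃ {K₁ K₁' : CMinus C₁} {K₂ K₂' : CMinus C₂} {K₃ K₃' : CMinus C₃}
    (f₁ : K₁.obj ⟶ K₁'.obj) (f₂ : K₂.obj ⟶ K₂'.obj) (f₃ : K₃.obj ⟶ K₃'.obj)
    (i₁ i₂ i₃ j : ℤ)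
    (h : ComplexShape.r (ComplexShape.up ℤ) (ComplexShape.up ℤ) (ComplexShape.up ℤ)
      (ComplexShape.up ℤ) (ComplexShape.up ℤ) (i₁, i₂, i₃) = j) :
    mapBifunctor₂₃.ι F G₂₃ K₁.obj K₂.obj K₃.obj (ComplexShape.up ℤ) (ComplexShape.up ℤ)
        (ComplexShape.up ℤ) i₁ i₂ i₃ j h ≫
      (mapBifunctorMap f₁ (mapBifunctorMap f₂ f₃ G₂₃ (ComplexShape.up ℤ)) F
        (ComplexShape.up ℤ)).f j =
    (F.map (f₁.f i₁)).app ((G₂₃.obj (K₂.obj.X i₂)).obj (K₃.obj.X i₃)) ≫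
      (F.obj (K₁'.obj.X i₁)).map ((G₂₃.map (f₂.f i₂)).app (K₃.obj.X i₃) ≫
        (G₂₃.obj (K₂'.obj.X i₂)).map (f₃.f i₃)) ≫
      mapBifunctor₂₃.ι F G₂₃ K₁'.obj K₂'.obj K₃'.obj (ComplexShape.up ℤ) (ComplexShape.up ℤ)
        (ComplexShape.up ℤ) i₁ i₂ i₃ j h := by
  have h' : ComplexShape.π (ComplexShape.up ℤ) (ComplexShape.up ℤ) (ComplexShape.up ℤ)
      (i₁, ComplexShape.π (ComplexShape.up ℤ) (ComplexShape.up ℤ) (ComplexShape.up ℤ)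
        (i₂, i₃)) = j := by
    change i₁ + (i₂ + i₃) = j
    change i₁ + i₂ + i₃ = j at h
    lia
  rw [mapBifunctor₂₃.ι_eq _ _ _ _ _ _ _ _ _ _ _ _ _ rfl h',
    mapBifunctor₂₃.ι_eq _ _ _ _ _ _ _ _ _ _ _ _ _ rfl h', Category.assoc, ι_mapBifunctorMap,
    ← NatTrans.naturality_assoc, ← Functor.map_comp_assoc, ι_mapBifunctorMap]
  simp

/-- The associator acts on each triple summand by the component of `a`, without signs. The claim is
therefore the naturality of `a` on each summand. -/
theorem associatorCMinusApp_naturality (a : bifunctorComp₁₂ F₁₂ G ≅ bifunctorComp₂₃ F G₂₃)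
    {K₁ K₁' : CMinus C₁} {K₂ K₂' : CMinus C₂} {K₃ K₃' : CMinus C₃}
    (f₁ : K₁.obj ⟶ K₁'.obj) (f₂ : K₂.obj ⟶ K₂'.obj) (f₃ : K₃.obj ⟶ K₃'.obj) :
    mapBifunctorMap (mapBifunctorMap f₁ f₂ F₁₂ (ComplexShape.up ℤ)) f₃ G (ComplexShape.up ℤ) ≫
      (mapBifunctorAssociator a K₁'.obj K₂'.obj K₃'.obj (ComplexShape.up ℤ)
        (ComplexShape.up ℤ) (ComplexShape.up ℤ)).hom =
    (mapBifunctorAssociator a K₁.obj K₂.obj K₃.obj (ComplexShape.up ℤ)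
        (ComplexShape.up ℤ) (ComplexShape.up ℤ)).hom ≫
      mapBifunctorMap f₁ (mapBifunctorMap f₂ f₃ G₂₃ (ComplexShape.up ℤ)) F (ComplexShape.up ℤ) := by
  ext j : 1
  refine mapBifunctor₁₂.hom_ext fun i₁ i₂ i₃ h => ?_
  rw [comp_f, comp_f, ← Category.assoc, ι_mapBifunctorMap₁₂ f₁ f₂ f₃ i₁ i₂ i₃ j h]
  dsimp only [mapBifunctorAssociator, Hom.isoOfComponents]
  rw [Category.assoc, Category.assoc, ι_mapBifunctorAssociatorX_hom,
    ι_mapBifunctorAssociatorX_hom_assoc]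
  erw [ι_mapBifunctorMap₂₃ (F := F) (G₂₃ := G₂₃) f₁ f₂ f₃ i₁ i₂ i₃ j h]
  have e := congr($(trifunctorComponent_naturality a (f₁.f i₁) (f₂.f i₂) (f₃.f i₃)) ≫
    mapBifunctor₂₃.ι F G₂₃ K₁'.obj K₂'.obj K₃'.obj (ComplexShape.up ℤ) (ComplexShape.up ℤ)
      (ComplexShape.up ℤ) i₁ i₂ i₃ j h)
  simp only [Category.assoc] at e
  exact e

theorem mapBifunctorMap_id {𝒜 ℬ 𝒞 : Type*} [Category* 𝒜] [Category* ℬ] [Category* 𝒞]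
    [Preadditive 𝒜] [Preadditive ℬ] [Preadditive 𝒞] [HasFiniteCoproducts 𝒞]
    (F : 𝒜 ⥤ ℬ ⥤ 𝒞) [F.Additive] [∀ X, (F.obj X).Additive] (K : CMinus 𝒜) (L : CMinus ℬ) :
    mapBifunctorMap (𝟙 K.obj) (𝟙 L.obj) F (ComplexShape.up ℤ) = 𝟙 _ :=
  congr(($(((mapBifunctorCMinus F).obj K).map_id L)).hom)

/-- The associativity isomorphism for bounded above complexes, as an isomorphism of trifunctors. -/
def associatorCMinus (a : bifunctorComp₁₂ F₁₂ G ≅ bifunctorComp₂₃ F G₂₃) :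
    bifunctorComp₁₂ (mapBifunctorCMinus F₁₂) (mapBifunctorCMinus G) ≅
      bifunctorComp₂₃ (mapBifunctorCMinus F) (mapBifunctorCMinus G₂₃) :=
  NatIso.ofComponents (fun K₁ => NatIso.ofComponents (fun K₂ => NatIso.ofComponents
    (fun K₃ => associatorCMinusApp a K₁ K₂ K₃)
    (fun {K₃ K₃'} f₃ => by
      refine ObjectProperty.hom_ext _ ?_
      have := associatorCMinusApp_naturality a (𝟙 K₁.obj) (𝟙 K₂.obj) f₃.hom
      rwa [mapBifunctorMap_id] at this))
    (fun {K₂ K₂'} f₂ => by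
      ext K₃ : 2
      exact ObjectProperty.hom_ext _
        (associatorCMinusApp_naturality a (𝟙 K₁.obj) f₂.hom (𝟙 K₃.obj))))
    (fun {K₁ K₁'} f₁ => by
      ext K₂ K₃ : 4
      refine ObjectProperty.hom_ext _ ?_
      have := associatorCMinusApp_naturality a f₁.hom (𝟙 K₂.obj) (𝟙 K₃.obj)
      rwa [mapBifunctorMap_id G₂₃] at this)

end Associator

/-! ### Derived functors from functorial resolutions -/

section Deformation

variable {C D H : Type*} [Category* C] [Category* D] [Category* H] (L : C ⥤ D)
  (W : MorphismProperty C) [L.IsLocalization W] (F : C ⥤ H) {Q : C ⥤ C} (ε : Q ⟶ 𝟭 C)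
  (hQ : W.IsInvertedBy (Q ⋙ F))

/-- The counit `L ⋙ LF ⟶ F` of the functor `LF` induced by `Q ⋙ F`. -/
def deformationCounit : L ⋙ Localization.lift (Q ⋙ F) hQ L ⟶ F :=
  (Localization.fac (Q ⋙ F) hQ L).hom ≫ Functor.whiskerRight ε F ≫ F.leftUnitor.hom

theorem deformationCounit_app (X : C) : (deformationCounit L W F ε hQ).app X =
    (Localization.fac (Q ⋙ F) hQ L).hom.app X ≫ F.map (ε.app X) := by
  simp [deformationCounit]

/-- If `Q` is a functorial resolution for a functor `F`, then `Q ⋙ F` induces the total left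
derived functor of `F`. -/
theorem isLeftDerivedFunctor_of_deformation (hε : ∀ X, W (ε.app X))
    (hF : ∀ X, IsIso (F.map (ε.app (Q.obj X)))) :
    (Localization.lift (Q ⋙ F) hQ L).IsLeftDerivedFunctor (deformationCounit L W F ε hQ) W := by
  have hL : ∀ X, IsIso (L.map (ε.app X)) := fun X => Localization.inverts L W _ (hε X)
  let e := Localization.fac (Q ⋙ F) hQ L
  -- Since `G` inverts the image of `ε`, a transformation `a` extends backwards as G L X ≅ G L Q X →
  -- F Q X.
  let lift (G : D ⥤ H) (a : L ⋙ G ⟶ F) : L ⋙ G ⟶ Q ⋙ F :=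
    { app := fun X => inv (G.map (L.map (ε.app X))) ≫ a.app (Q.obj X)
      naturality := fun X Y f => by
        have h₁ := a.naturality (Q.map f)
        have h₂ := congr(G.map (L.map $(ε.naturality f)))
        dsimp at h₁ h₂ ⊢
        simp only [Functor.map_comp] at h₂
        rw [← cancel_epi (G.map (L.map (ε.app X))), ← reassoc_of% h₂]
        simp [h₁] }
  have hlift (G : D ⥤ H) (a : L ⋙ G ⟶ F) : ∃ b : G ⟶ Localization.lift (Q ⋙ F) hQ L,
      Functor.whiskerLeft L b ≫ deformationCounit L W F ε hQ = a := by
    refine ⟨Localization.liftNatTrans L W (L ⋙ G) (Q ⋙ F) G _ (lift G a), ?_⟩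
    ext X
    have n := a.naturality (ε.app X)
    dsimp at n ⊢
    rw [Localization.liftNatTrans_app, deformationCounit_app]
    change ((𝟙 _ ≫ (inv (G.map (L.map (ε.app X))) ≫ a.app (Q.obj X)) ≫ e.inv.app X) ≫
      e.hom.app X ≫ F.map (ε.app X)) = _
    rw [Category.id_comp, Category.assoc, Iso.inv_hom_id_app_assoc, Category.assoc, ← n,
      IsIso.inv_hom_id_assoc]
  have huniq (G : D ⥤ H) (b b' : G ⟶ Localization.lift (Q ⋙ F) hQ L)
      (h : Functor.whiskerLeft L b ≫ deformationCounit L W F ε hQ =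
        Functor.whiskerLeft L b' ≫ deformationCounit L W F ε hQ) : b = b' := by
    -- On objects `Q X` the counit is invertible by `hF`, so `b` and `b'` agree there. Naturality
    -- along the isomorphism `L (ε X)` carries this over to `X`.
    refine Localization.natTrans_ext L W fun X => ?_
    have h₁ := NatTrans.congr_app h (Q.obj X)
    dsimp at h₁
    rw [deformationCounit_app] at h₁
    have := hF X
    rw [← Category.assoc, ← Category.assoc, cancel_mono, cancel_mono] at h₁
    have n := b.naturality (L.map (ε.app X))
    have n' := b'.naturality (L.map (ε.app X))
    rw [h₁, ← n', cancel_epi] at n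
    exact n
  -- The universal property of a right Kan extension: terminality among functors `G` equipped with a
  -- map `L ⋙ G ⟶ F`.
  refine ⟨⟨⟨IsTerminal.ofUniqueHom
    (fun E => CostructuredArrow.homMk (hlift E.left E.hom).choose (hlift E.left E.hom).choose_spec)
    fun E m => ?_⟩⟩⟩
  refine CostructuredArrow.hom_ext _ _ (huniq _ _ _ ?_)
  exact (CostructuredArrow.w m).trans (hlift E.left E.hom).choose_spec.symm

end Deformation

/-! ### Exactness and projectives for finitely generated modules -/

section FGModules

variable {R : Type u} [Ring R] [IsNoetherianRing R]

instance : (forget₂ (FGModuleCat.{u} R) (ModuleCat.{u} R)).Additive where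

theorem fgModuleCat_exact_iff (S : ShortComplex (FGModuleCat.{u} R)) :
    S.Exact ↔ ∀ x : S.X₂, S.g.hom.hom x = 0 → ∃ y : S.X₁, S.f.hom.hom y = x := by
  rw [← S.exact_map_iff_of_faithful (forget₂ (FGModuleCat.{u} R) (ModuleCat.{u} R)),
    ShortComplex.moduleCat_exact_iff]
  rfl

theorem fgModuleCat_exactAt_iff (K : CochainComplex (FGModuleCat.{u} R) ℤ) (i j l : ℤ)
    (hij : i + 1 = j) (hjl : j + 1 = l) :
    K.ExactAt j ↔ ∀ x : K.X j, (K.d j l).hom.hom x = 0 → ∃ y : K.X i, (K.d i j).hom.hom y = x := by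
  rw [K.exactAt_iff' i j l ((ComplexShape.up ℤ).prev_eq' hij) ((ComplexShape.up ℤ).next_eq' hjl),
    fgModuleCat_exact_iff]
  rfl

theorem fgModuleCat_surjective_of_epi {X Y : FGModuleCat.{u} R} (f : X ⟶ Y) [Epi f] :
    Function.Surjective f.hom.hom :=
  (ModuleCat.epi_iff_surjective ((forget₂ (FGModuleCat.{u} R) (ModuleCat.{u} R)).map f)).1
    inferInstance

theorem fgModuleCat_epi_of_surjective {X Y : FGModuleCat.{u} R} (f : X ⟶ Y)
    (hf : Function.Surjective f.hom.hom) : Epi f :=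
  (forget₂ (FGModuleCat.{u} R) (ModuleCat.{u} R)).epi_of_epi_map
    ((ModuleCat.epi_iff_surjective _).2 hf)

variable (R) in
/-- The free module of rank `n`. -/
abbrev fgFree (n : ℕ) : FGModuleCat.{u} R := FGModuleCat.of R (Fin n → R)

instance (n : ℕ) : Projective (fgFree R n) where
  factors {E X} f e _ := by
    obtain ⟨g, hg⟩ := Module.projective_lifting_property e.hom.hom f.hom.hom
      (fgModuleCat_surjective_of_epi e)
    exact ⟨FGModuleCat.ofHom g, FGModuleCat.hom_ext hg⟩

theorem exists_fgFree_epi (X : FGModuleCat.{u} R) : ∃ (n : ℕ) (p : fgFree R n ⟶ X), Epi p := by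
  obtain ⟨n, p, hp⟩ := Module.Finite.exists_fin' R X
  exact ⟨n, FGModuleCat.ofHom p, fgModuleCat_epi_of_surjective _ hp⟩

instance : EnoughProjectives (FGModuleCat.{u} R) where
  presentation X := by
    obtain ⟨n, p, hp⟩ := exists_fgFree_epi X
    exact ⟨{ p := fgFree R n, f := p, epi := hp }⟩

theorem quasiIso_map_of_exact {R' : Type u} [Ring R'] [IsNoetherianRing R']
    (H : FGModuleCat.{u} R ⥤ FGModuleCat.{u} R') [H.Additive]
    (h : ∀ S : ShortComplex (FGModuleCat.{u} R), S.Exact → (S.map H).Exact)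
    {K L : CochainComplex (FGModuleCat.{u} R) ℤ} (f : K ⟶ L) [QuasiIso f] :
    QuasiIso ((H.mapHomologicalComplex (ComplexShape.up ℤ)).map f) := by
  have : H.PreservesHomology := ((Functor.exact_tfae H).out 1 2).1 h
  infer_instance

end FGModules

/-! ### Quasi-isomorphisms through acyclic mapping cones -/

section MappingCone

open HomologicalComplex CochainComplex

variable {𝒜 : Type*} [Category* 𝒜] [Abelian 𝒜]

theorem quasiIso_iff_acyclic_mappingCone {K L : CochainComplex 𝒜 ℤ} (f : K ⟶ L) :
    QuasiIso f ↔ (mappingCone f).Acyclic := by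
  rw [← HomotopyCategory.quotient_obj_mem_subcategoryAcyclic_iff_acyclic,
    ← HomologicalComplex.mem_quasiIso_iff, ← HomotopyCategory.quotient_map_mem_quasiIso_iff,
    HomotopyCategory.quasiIso_eq_trW_subcategoryAcyclic]
  exact ObjectProperty.trW_iff_of_distinguished _ _
    (HomotopyCategory.mappingCone_triangleh_distinguished f)

/-- Additive functors commute with mapping cones, so a functor that is not exact can be tested on
the cone of the given map alone. -/
theorem quasiIso_map_of_acyclic_mappingCone {ℬ : Type*} [Category* ℬ] [Abelian ℬ] (H : 𝒜 ⥤ ℬ)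
    [H.Additive] {K L : CochainComplex 𝒜 ℤ} (f : K ⟶ L)
    (h : ((H.mapHomologicalComplex (ComplexShape.up ℤ)).obj (mappingCone f)).Acyclic) :
    QuasiIso ((H.mapHomologicalComplex (ComplexShape.up ℤ)).map f) := by
  rw [quasiIso_iff_acyclic_mappingCone]
  exact fun i => (h i).of_iso (mappingCone.mapHomologicalComplexIso f H)

end MappingCone

/-! ### One-sided projectivity by dual bases, and one-sided contractions -/

section ProjAlong

variable {k A B S : Type u} [Field k] [Ring A] [Algebra k A] [Ring B] [Algebra k B]
  [Ring S] [Algebra k S]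

/-- `X`, with scalars restricted along `ρ`, has a finite dual basis, that is, it is a finitely
generated projective `S`-module. -/
def IsProjAlong (ρ : S →ₐ[k] A ⊗[k] Bᵐᵒᵖ) (X : FGBimod k A B) : Prop :=
  ∃ (ι : Type) (_ : Fintype ι) (x : ι → X) (φ : ι → X →ₗ[k] S),
    (∀ i s y, φ i (ρ s • y) = s * φ i y) ∧ ∀ y, ∑ i, ρ (φ i y) • x i = y

/-- The hypothesis makes `X` a retract of a finite sum of the `Y j`; the dual bases are pulled back
along `f` and pushed forward along `g`. -/
theorem IsProjAlong.of_sum {ρ : S →ₐ[k] A ⊗[k] Bᵐᵒᵖ} {X : FGBimod k A B} {J : Type} (s : Finset J)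
    (Y : J → FGBimod k A B) (hY : ∀ j, IsProjAlong ρ (Y j)) (f : ∀ j, X ⟶ Y j) (g : ∀ j, Y j ⟶ X)
    (h : ∀ x, ∑ j ∈ s, (g j).hom.hom ((f j).hom.hom x) = x) : IsProjAlong ρ X := by
  choose ι _ y φ hφ hy using hY
  refine ⟨Σ j : s, ι j, inferInstance, fun a => (g a.1).hom.hom (y _ a.2),
    fun a => (φ _ a.2).comp ((f a.1).hom.hom.restrictScalars k), ?_, ?_⟩
  · intro a t z
    simp [hφ]
  · intro z
    rw [Fintype.sum_sigma]
    conv_rhs => rw [← h z, ← Finset.sum_coe_sort]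
    refine Finset.sum_congr rfl fun j _ => ?_
    conv_rhs => rw [← hy j ((f j).hom.hom z), map_sum]
    simp

/-- The family `(t, ψ)` is a dual basis of the enveloping algebra over `S`. Products of its members
with those of a dual basis of `X` over the enveloping algebra give one over `S`. -/
theorem IsProjAlong.trans {ρ : S →ₐ[k] A ⊗[k] Bᵐᵒᵖ} {X : FGBimod k A B} {J : Type} [Fintype J]
    (t : J → A ⊗[k] Bᵐᵒᵖ) (ψ : J → A ⊗[k] Bᵐᵒᵖ →ₗ[k] S)
    (hψ : ∀ j s r, ψ j (ρ s * r) = s * ψ j r) (ht : ∀ r, ∑ j, ρ (ψ j r) * t j = r)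
    (hX : IsProjAlong (AlgHom.id k _) X) : IsProjAlong ρ X := by
  obtain ⟨ι, _, x, φ, hφ, hx⟩ := hX
  refine ⟨ι × J, inferInstance, fun a => t a.2 • x a.1, fun a => (ψ a.2).comp (φ a.1), ?_, ?_⟩
  · intro a s y
    have := hφ a.1 (ρ s) y
    simp only [AlgHom.id_apply] at this
    simp [this, hψ]
  · intro y
    rw [Fintype.sum_prod_type]
    conv_rhs => rw [← hx y]
    refine Finset.sum_congr rfl fun i _ => ?_
    simp only [LinearMap.comp_apply, smul_smul, ← Finset.sum_smul, ht, AlgHom.id_apply]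

theorem isProjAlong_id_of_projective [FiniteDimensional k A] [FiniteDimensional k B]
    (X : FGBimod k A B) [Projective X] : IsProjAlong (AlgHom.id k _) X := by
  obtain ⟨n, p, hp⟩ := exists_fgFree_epi X
  let s := Projective.factorThru (𝟙 X) p
  have hs : s ≫ p = 𝟙 X := Projective.factorThru_comp _ _
  refine ⟨Fin n, inferInstance, fun i => p.hom.hom (Pi.single i 1),
    fun i => ((LinearMap.proj i).comp s.hom.hom).restrictScalars k, ?_, ?_⟩
  · intro i t y
    change (s.hom.hom (t • y)) i = t * (s.hom.hom y) i
    rw [map_smul]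
    rfl
  · intro y
    have h : p.hom.hom (s.hom.hom y) = y := congr(($hs).hom.hom y)
    conv_rhs => rw [← h, ← LinearMap.sum_single_apply _ (s.hom.hom y), map_sum]
    refine Finset.sum_congr rfl fun i _ => ?_
    rw [← map_smul]
    congr 1
    ext j : 1
    change _ * (Pi.single i 1 : Fin n → A ⊗[k] Bᵐᵒᵖ) j =
      (Pi.single i ((s.hom.hom y : Fin n → A ⊗[k] Bᵐᵒᵖ) i) : Fin n → A ⊗[k] Bᵐᵒᵖ) j
    by_cases hij : j = i
    · subst hij
      simp
    · simp [hij]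

/-- The projective lifting property for maps linear only along `ρ`: lift the images of the dual
basis elements and extend by the coordinates. -/
theorem IsProjAlong.exists_lift {ρ : S →ₐ[k] A ⊗[k] Bᵐᵒᵖ} {X : FGBimod k A B}
    (hX : IsProjAlong ρ X) {Y Z : FGBimod k A B} (f : Y ⟶ Z) (v : X →ₗ[k] Z)
    (hv : ∀ s x, v (ρ s • x) = ρ s • v x) (h : ∀ x, ∃ y, f.hom.hom y = v x) :
    ∃ w : X →ₗ[k] Y, (∀ s x, w (ρ s • x) = ρ s • w x) ∧ ∀ x, f.hom.hom (w x) = v x := by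
  obtain ⟨ι, _, x, φ, hφ, hx⟩ := hX
  choose y hy using fun i => h (x i)
  refine ⟨∑ i, ((LinearMap.toSpanSingleton _ Y (y i)).restrictScalars k).comp
    (ρ.toLinearMap.comp (φ i)), ?_, ?_⟩
  · intro s z
    simp [LinearMap.sum_apply, hφ, Finset.smul_sum, smul_smul]
  · intro z
    conv_rhs => rw [← hx z, map_sum]
    simp [LinearMap.sum_apply, hv, hy]

variable [FiniteDimensional k A] [FiniteDimensional k B]

/-- The algebra A ⊗ Bᵒᵖ is free as a left A-module, on 1 ⊗ b_j for a k-basis b_j of Bᵒᵖ. -/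
theorem isProjAlong_includeLeft_of_projective (X : FGBimod k A B) [Projective X] :
    IsProjAlong (Algebra.TensorProduct.includeLeft : A →ₐ[k] A ⊗[k] Bᵐᵒᵖ) X := by
  let b := Module.finBasis k Bᵐᵒᵖ
  refine IsProjAlong.trans (fun j => 1 ⊗ₜ b j)
    (fun j => (TensorProduct.rid k A).toLinearMap.comp (TensorProduct.map .id (b.coord j))) ?_ ?_
    (isProjAlong_id_of_projective X)
  · intro j s r
    induction r using TensorProduct.induction_on with
    | zero => simp
    | add x y hx hy => simp only [mul_add, map_add, hx, hy]
    | tmul x y => simp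
  · intro r
    induction r using TensorProduct.induction_on with
    | zero => simp
    | add x y hx hy =>
      conv_rhs => rw [← hx, ← hy]
      simp only [map_add, add_mul, Finset.sum_add_distrib]
    | tmul x y =>
      conv_rhs => rw [← b.sum_repr y, TensorProduct.tmul_sum]
      simp [TensorProduct.smul_tmul']

theorem isProjAlong_includeRight_of_projective (X : FGBimod k A B) [Projective X] :
    IsProjAlong (Algebra.TensorProduct.includeRight : Bᵐᵒᵖ →ₐ[k] A ⊗[k] Bᵐᵒᵖ) X := by
  let b := Module.finBasis k A
  refine IsProjAlong.trans (fun j => b j ⊗ₜ 1)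
    (fun j => (TensorProduct.lid k Bᵐᵒᵖ).toLinearMap.comp (TensorProduct.map (b.coord j) .id)) ?_ ?_
    (isProjAlong_id_of_projective X)
  · intro j s r
    induction r using TensorProduct.induction_on with
    | zero => simp
    | add x y hx hy => simp only [mul_add, map_add, hx, hy]
    | tmul x y => simp
  · intro r
    induction r using TensorProduct.induction_on with
    | zero => simp
    | add x y hx hy =>
      conv_rhs => rw [← hx, ← hy]
      simp only [map_add, add_mul, Finset.sum_add_distrib]
    | tmul x y =>
      conv_rhs => rw [← b.sum_repr x, TensorProduct.sum_tmul]
      simp [TensorProduct.smul_tmul']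

/-- Descending induction on the degree, starting where `E` vanishes. Each degree gets its own pair
`(s, t)`, which is enough to test acyclicity after tensoring. -/
theorem exists_contraction {ρ : S →ₐ[k] A ⊗[k] Bᵐᵒᵖ} (E : CochainComplex (FGBimod k A B) ℤ)
    (hE : E.Acyclic) (hE' : ∀ n, IsProjAlong ρ (E.X n)) (N : ℤ) (hN : E.IsStrictlyLE N)
    (i j l : ℤ) (hij : i + 1 = j) (hjl : j + 1 = l) :
    ∃ (s : E.X j →ₗ[k] E.X i) (t : E.X l →ₗ[k] E.X j), (∀ r x, s (ρ r • x) = ρ r • s x) ∧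
      (∀ r x, t (ρ r • x) = ρ r • t x) ∧
      ∀ x, (E.d i j).hom.hom (s x) + t ((E.d j l).hom.hom x) = x := by
  suffices H : ∀ (n : ℕ) (i j l : ℤ) (_ : i + 1 = j) (_ : j + 1 = l) (_ : N + 1 - n ≤ j),
      ∃ (s : E.X j →ₗ[k] E.X i) (t : E.X l →ₗ[k] E.X j), (∀ r x, s (ρ r • x) = ρ r • s x) ∧
        (∀ r x, t (ρ r • x) = ρ r • t x) ∧
        ∀ x, (E.d i j).hom.hom (s x) + t ((E.d j l).hom.hom x) = x from
    H (N + 1 - j).toNat i j l hij hjl (by lia)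
  intro n
  induction n with
  | zero =>
    intro i j l hij hjl hj
    refine ⟨0, 0, by simp, by simp, fun x => ?_⟩
    have h : 𝟙 (E.X j) = 0 := (E.isZero_of_isStrictlyLE N j (by lia)).eq_of_src _ _
    have hx : x = 0 := congr(($h).hom.hom x)
    simp [hx]
  | succ n ih =>
    intro i j l hij hjl hj
    obtain ⟨s, t, hs, ht, hst⟩ := ih j l (l + 1) hjl rfl (by push_cast at hj; lia)
    -- The map `id - s d` takes values in cocycles, as `d s d = d` by the identity in degree `l`.
    -- Acyclicity makes these coboundaries, so it lifts through `d`.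
    obtain ⟨w, hw, hw'⟩ := (hE' j).exists_lift (E.d i j)
      (.id - s.comp ((E.d j l).hom.hom.restrictScalars k))
      (fun r x => by simp [hs, smul_sub]) (fun x => by
        refine (fgModuleCat_exactAt_iff E i j l hij hjl).1 (hE j) _ ?_
        have h := hst ((E.d j l).hom.hom x)
        have h₀ : (E.d l (l + 1)).hom.hom ((E.d j l).hom.hom x) = 0 :=
          congr(($(E.d_comp_d j l (l + 1))).hom.hom x)
        rw [h₀, map_zero, add_zero] at h
        simp [h])
    exact ⟨w, s, hw, hs, fun x => by simp [hw']⟩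

open HomologicalComplex CochainComplex in
theorem isProjAlong_mappingCone {ρ : S →ₐ[k] A ⊗[k] Bᵐᵒᵖ} {K L : CochainComplex (FGBimod k A B) ℤ}
    (f : K ⟶ L) (hK : ∀ n, IsProjAlong ρ (K.X n)) (hL : ∀ n, IsProjAlong ρ (L.X n)) (n : ℤ) :
    IsProjAlong ρ ((mappingCone f).X n) := by
  refine IsProjAlong.of_sum Finset.univ (fun b : Bool => cond b (K.X (n + 1)) (L.X n))
    (fun b => by cases b <;> simp only [cond_true, cond_false, hK, hL])
    (fun | true => (mappingCone.fst f).1.v n (n + 1) rfl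
         | false => (mappingCone.snd f).v n n (add_zero n))
    (fun | true => (mappingCone.inl f).v (n + 1) n (by lia)
         | false => (mappingCone.inr f).f n) fun x => ?_
  have h := mappingCone.id_X f n (n + 1) rfl
  rw [Fintype.sum_bool]
  exact congr(($h).hom.hom x)

open HomologicalComplex CochainComplex in
theorem isStrictlyLE_mappingCone {𝒜 : Type*} [Category* 𝒜] [Abelian 𝒜] {K L : CochainComplex 𝒜 ℤ}
    (f : K ⟶ L) (n : ℤ) [K.IsStrictlyLE n] [L.IsStrictlyLE n] :
    (mappingCone f).IsStrictlyLE n := by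
  rw [isStrictlyLE_iff]
  intro i hi
  rw [mappingCone.isZero_X_iff]
  exact ⟨K.isZero_of_isStrictlyLE n _ (by lia), L.isZero_of_isStrictlyLE n _ (by lia)⟩

end ProjAlong

/-! ### Pure tensors and maps out of a balanced tensor product -/

section TensorAPI

variable {k A B C : Type u} [Field k] [Ring A] [Algebra k A] [Ring B] [Algebra k B]
  [Ring C] [Algebra k C]

theorem zero_smul_bimod (X : FGBimod k A B) (x : X) : (0 : A ⊗[k] Bᵐᵒᵖ) • x = 0 :=
  Module.zero_smul x

/-- A `k`-linear map commuting with both actions, as a morphism of bimodules. -/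
def bimodHom {X Y : FGBimod k A B} (f : X →ₗ[k] Y)
    (hl : ∀ (a : A) (x : X), f ((a ⊗ₜ[k] (1 : Bᵐᵒᵖ)) • x) = (a ⊗ₜ[k] (1 : Bᵐᵒᵖ)) • f x)
    (hr : ∀ (b : Bᵐᵒᵖ) (x : X), f (((1 : A) ⊗ₜ[k] b) • x) = ((1 : A) ⊗ₜ[k] b) • f x) : X ⟶ Y :=
  FGModuleCat.ofHom
    { toFun := f
      map_add' := map_add f
      map_smul' := fun r x => by
        induction r using TensorProduct.induction_on with
        | zero =>
          exact (congrArg f (zero_smul_bimod X x)).trans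
            ((map_zero f).trans (zero_smul_bimod Y (f x)).symm)
        | add r s hr hs => simp only [add_smul, map_add, hr, hs, RingHom.id_apply]
        | tmul a b =>
          have h : a ⊗ₜ[k] b = (a ⊗ₜ[k] (1 : Bᵐᵒᵖ)) * ((1 : A) ⊗ₜ[k] b) := by simp
          rw [h, mul_smul, hl, hr, RingHom.id_apply, mul_smul] }

variable [FiniteDimensional k A] [FiniteDimensional k B] [FiniteDimensional k C]

/-- The tensor product of two bimodules. -/
abbrev tensorObj (L : FGBimod k A B) (M : FGBimod k B C) : FGBimod k A C :=
  ((tensorBimod k A B C).obj L).obj M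

/-- The pure tensor `l ⊗ m` in `L ⊗_B M`. -/
def tmul (L : FGBimod k A B) (M : FGBimod k B C) (l : L) (m : M) : tensorObj L M :=
  BalancedTensor.mk k A B C L M (l ⊗ₜ m)

section

variable (L : FGBimod k A B) (M : FGBimod k B C)

theorem add_tmul (l l' : L) (m : M) : tmul L M (l + l') m = tmul L M l m + tmul L M l' m := by
  change BalancedTensor.mk k A B C L M _ =
    BalancedTensor.mk k A B C L M _ + BalancedTensor.mk k A B C L M _
  rw [← map_add, TensorProduct.add_tmul]

theorem tmul_add (l : L) (m m' : M) : tmul L M l (m + m') = tmul L M l m + tmul L M l m' := by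
  change BalancedTensor.mk k A B C L M _ =
    BalancedTensor.mk k A B C L M _ + BalancedTensor.mk k A B C L M _
  rw [← map_add, TensorProduct.tmul_add]

theorem tmul_balanced (l : L) (b : B) (m : M) :
    tmul L M (((1 : A) ⊗ₜ[k] MulOpposite.op b) • l) m =
      tmul L M l ((b ⊗ₜ[k] (1 : Cᵐᵒᵖ)) • m) :=
  (Submodule.Quotient.eq _).2 (Submodule.subset_span ⟨l, b, m, rfl⟩)

theorem tmul_smul_smul (a : A) (c : Cᵐᵒᵖ) (l : L) (m : M) :
    tmul L M ((a ⊗ₜ[k] (1 : Bᵐᵒᵖ)) • l) (((1 : B) ⊗ₜ[k] c) • m) =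
      (a ⊗ₜ[k] c) • tmul L M l m :=
  congrArg (BalancedTensor.mk k A B C L M) (outerAction_tmul k A B C L M a c l m).symm

theorem smul_left_tmul (a : A) (l : L) (m : M) :
    (a ⊗ₜ[k] (1 : Cᵐᵒᵖ)) • tmul L M l m = tmul L M ((a ⊗ₜ[k] (1 : Bᵐᵒᵖ)) • l) m := by
  rw [← tmul_smul_smul, ← Algebra.TensorProduct.one_def, one_smul]

theorem smul_right_tmul (c : Cᵐᵒᵖ) (l : L) (m : M) :
    ((1 : A) ⊗ₜ[k] c) • tmul L M l m = tmul L M l (((1 : B) ⊗ₜ[k] c) • m) := by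
  rw [← tmul_smul_smul, ← Algebra.TensorProduct.one_def, one_smul]

theorem smul_tmul (c : k) (l : L) (m : M) : c • tmul L M l m = tmul L M (c • l) m := by
  have h := smul_left_tmul L M (algebraMap k A c) l m
  rwa [← Algebra.TensorProduct.algebraMap_apply, ← Algebra.TensorProduct.algebraMap_apply] at h

theorem tmul_smul (c : k) (l : L) (m : M) : tmul L M l (c • m) = c • tmul L M l m := by
  have h := smul_right_tmul L M (algebraMap k _ c) l m
  rw [← Algebra.TensorProduct.algebraMap_apply', ← Algebra.TensorProduct.algebraMap_apply'] at h
  exact h.symm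

/-- Pure tensors as a bilinear map. -/
def tmulₗ : L →ₗ[k] M →ₗ[k] tensorObj L M :=
  LinearMap.mk₂ k (tmul L M) (add_tmul L M) (fun c l m => (smul_tmul L M c l m).symm)
    (tmul_add L M) (fun c l m => tmul_smul L M c l m)

theorem tmulₗ_apply (l : L) (m : M) : tmulₗ L M l m = tmul L M l m := rfl

variable {L M}

@[elab_as_elim]
theorem tensor_induction {p : tensorObj L M → Prop} (hz : p 0) (ht : ∀ l m, p (tmul L M l m))
    (ha : ∀ x y, p x → p y → p (x + y)) (x : tensorObj L M) : p x := by
  obtain ⟨x, rfl⟩ := BalancedTensor.mk_surjective k A B C L M x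
  induction x using TensorProduct.induction_on with
  | zero => exact hz
  | tmul l m => exact ht l m
  | add x y hx hy => exact (map_add (BalancedTensor.mk k A B C L M) x y) ▸ ha _ _ hx hy

/-- The `k`-linear map on `L ⊗_B M` given by a balanced bilinear map. -/
def tensorLift {Z : Type u} [AddCommGroup Z] [Module k Z] (φ : L →ₗ[k] M →ₗ[k] Z)
    (hφ : ∀ (l : L) (b : B) (m : M),
      φ (((1 : A) ⊗ₜ[k] MulOpposite.op b) • l) m = φ l ((b ⊗ₜ[k] (1 : Cᵐᵒᵖ)) • m)) :
    tensorObj L M →ₗ[k] Z :=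
  have h : balancedRelations k A B C L M ≤ LinearMap.ker (TensorProduct.lift φ) := by
    refine Submodule.span_le.2 ?_
    rintro _ ⟨l, b, m, rfl⟩
    simp [hφ]
  { toFun := (balancedRelations k A B C L M).liftQ (TensorProduct.lift φ) h
    map_add' := map_add _
    map_smul' := fun c x => by
      let ψ : BalancedTensor k A B C L M →ₗ[k] Z :=
        (balancedRelations k A B C L M).liftQ (TensorProduct.lift φ) h
      have hψ (y : BalancedTensor k A B C L M) :
          ψ (algebraMap k (A ⊗[k] Cᵐᵒᵖ) c • y) = c • ψ y := by
        rw [algebraMap_smul, map_smul]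
      exact hψ x }

@[simp]
theorem tensorLift_tmul {Z : Type u} [AddCommGroup Z] [Module k Z] (φ : L →ₗ[k] M →ₗ[k] Z)
    (hφ : ∀ (l : L) (b : B) (m : M),
      φ (((1 : A) ⊗ₜ[k] MulOpposite.op b) • l) m = φ l ((b ⊗ₜ[k] (1 : Cᵐᵒᵖ)) • m))
    (l : L) (m : M) : tensorLift φ hφ (tmul L M l m) = φ l m := rfl

theorem tensorObj_hom_ext {Z : FGBimod k A C} {f g : tensorObj L M ⟶ Z}
    (h : ∀ l m, f.hom.hom (tmul L M l m) = g.hom.hom (tmul L M l m)) : f = g :=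
  FGModuleCat.hom_ext (BalancedTensor.hom_ext k A B C h)

end

/-! ### Exactness and projectivity of one-sided tensor products -/

section Exactness

variable {L : FGBimod k A B} {M : FGBimod k B C}

/-- The map `s ⊗ 1` for a map `s` of right modules. -/
def tensorMapLeft {L' : FGBimod k A B} (s : L →ₗ[k] L')
    (hs : ∀ (b : Bᵐᵒᵖ) x, s (((1 : A) ⊗ₜ[k] b) • x) = ((1 : A) ⊗ₜ[k] b) • s x)
    (M : FGBimod k B C) : tensorObj L M →ₗ[k] tensorObj L' M :=
  tensorLift ((tmulₗ L' M).comp s) fun l b m => by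
    simp [tmulₗ_apply, hs, tmul_balanced]

/-- The map `1 ⊗ s` for a map `s` of left modules. -/
def tensorMapRight {M' : FGBimod k B C} (s : M →ₗ[k] M')
    (hs : ∀ (b : B) x, s ((b ⊗ₜ[k] (1 : Cᵐᵒᵖ)) • x) = (b ⊗ₜ[k] (1 : Cᵐᵒᵖ)) • s x)
    (L : FGBimod k A B) : tensorObj L M →ₗ[k] tensorObj L M' :=
  tensorLift ((tmulₗ L M').compl₂ s) fun l b m => by
    simp [tmulₗ_apply, hs, tmul_balanced]

/-- A dual basis of `M` over B exhibits Y ⊗_B M as a retract of a finite power of Y, naturally in Y: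
`Φ i` sends y ⊗ m to y φ_i(m), and z is recovered as ∑ Φ_i(z) ⊗ x_i. Exactness passes to retracts.
-/
theorem exact_tensor_of_isProjAlong_includeLeft
    (hM : IsProjAlong (Algebra.TensorProduct.includeLeft : B →ₐ[k] B ⊗[k] Cᵐᵒᵖ) M)
    (S : ShortComplex (FGBimod k A B)) (hS : S.Exact) :
    (S.map ((tensorBimod k A B C).flip.obj M)).Exact := by
  obtain ⟨ι, _, x, φ, hφ, hx⟩ := hM
  simp only [Algebra.TensorProduct.includeLeft_apply] at hφ hx
  rw [fgModuleCat_exact_iff] at hS ⊢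
  let act (Y : FGBimod k A B) : Bᵐᵒᵖ →ₗ[k] Y →ₗ[k] Y :=
    ((Algebra.lsmul k k Y).comp
      (Algebra.TensorProduct.includeRight : Bᵐᵒᵖ →ₐ[k] A ⊗[k] Bᵐᵒᵖ)).toLinearMap
  let Φ (i : ι) (Y : FGBimod k A B) : tensorObj Y M →ₗ[k] Y :=
    tensorLift (((act Y).comp ((MulOpposite.opLinearEquiv k).toLinearMap.comp (φ i))).flip)
      (fun l b m => by simp [act, hφ, smul_smul])
  have hΦ (i : ι) (Y : FGBimod k A B) (y : Y) (m : M) : Φ i Y (tmul Y M y m) =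
      ((1 : A) ⊗ₜ[k] MulOpposite.op (φ i m)) • y := rfl
  have hsum (Y : FGBimod k A B) (z : tensorObj Y M) : ∑ i, tmul Y M (Φ i Y z) (x i) = z := by
    induction z using tensor_induction with
    | hz => simp [← tmulₗ_apply]
    | ht l m =>
      simp only [hΦ, tmul_balanced]
      simp only [← tmulₗ_apply, ← map_sum, hx]
    | ha z w hz hw =>
      conv_rhs => rw [← hz, ← hw]
      simp [add_tmul, Finset.sum_add_distrib]
  have hnat {Y Y' : FGBimod k A B} (g : Y ⟶ Y') (i : ι) (z : tensorObj Y M) :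
      g.hom.hom (Φ i Y z) =
        Φ i Y' ((((tensorBimod k A B C).flip.obj M).map g).hom.hom z) := by
    induction z using tensor_induction with
    | hz => simp
    | ht l m => exact map_smul g.hom.hom _ _
    | ha z w hz hw => simp only [map_add, hz, hw]
  intro z hz
  choose y hy using fun i => hS (Φ i _ z) ((hnat S.g i z).trans (by
    rw [show (((tensorBimod k A B C).flip.obj M).map S.g).hom.hom z = 0 from hz, map_zero]))
  refine ⟨∑ i, tmul S.X₁ M (y i) (x i), ?_⟩
  refine (map_sum (((tensorBimod k A B C).flip.obj M).map S.f).hom.hom _ _).trans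
    ((Finset.sum_congr rfl fun i _ => ?_).trans (hsum S.X₂ z))
  exact congrArg (fun w => tmul S.X₂ M w (x i)) (hy i)

theorem exact_tensor_of_isProjAlong_includeRight
    (hL : IsProjAlong (Algebra.TensorProduct.includeRight : Bᵐᵒᵖ →ₐ[k] A ⊗[k] Bᵐᵒᵖ) L)
    (S : ShortComplex (FGBimod k B C)) (hS : S.Exact) :
    (S.map ((tensorBimod k A B C).obj L)).Exact := by
  obtain ⟨ι, _, x, φ, hφ, hx⟩ := hL
  simp only [Algebra.TensorProduct.includeRight_apply] at hφ hx
  rw [fgModuleCat_exact_iff] at hS ⊢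
  let act (Y : FGBimod k B C) : B →ₗ[k] Y →ₗ[k] Y :=
    ((Algebra.lsmul k k Y).comp
      (Algebra.TensorProduct.includeLeft : B →ₐ[k] B ⊗[k] Cᵐᵒᵖ)).toLinearMap
  let Φ (i : ι) (Y : FGBimod k B C) : tensorObj L Y →ₗ[k] Y :=
    tensorLift ((act Y).comp ((MulOpposite.opLinearEquiv k).symm.toLinearMap.comp (φ i)))
      (fun l b m => by simp [act, hφ, smul_smul])
  have hΦ (i : ι) (Y : FGBimod k B C) (l : L) (y : Y) : Φ i Y (tmul L Y l y) =
      ((φ i l).unop ⊗ₜ[k] (1 : Cᵐᵒᵖ)) • y := rfl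
  have hsum (Y : FGBimod k B C) (z : tensorObj L Y) : ∑ i, tmul L Y (x i) (Φ i Y z) = z := by
    induction z using tensor_induction with
    | hz => simp [← tmulₗ_apply]
    | ht l m =>
      simp only [hΦ, ← tmul_balanced, MulOpposite.op_unop]
      simp only [← tmulₗ_apply, ← LinearMap.sum_apply, ← map_sum, hx]
    | ha z w hz hw =>
      conv_rhs => rw [← hz, ← hw]
      simp [tmul_add, Finset.sum_add_distrib]
  have hnat {Y Y' : FGBimod k B C} (g : Y ⟶ Y') (i : ι) (z : tensorObj L Y) :
      g.hom.hom (Φ i Y z) = Φ i Y' ((((tensorBimod k A B C).obj L).map g).hom.hom z) := by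
    induction z using tensor_induction with
    | hz => simp
    | ht l m => exact map_smul g.hom.hom _ _
    | ha z w hz hw => simp only [map_add, hz, hw]
  intro z hz
  choose y hy using fun i => hS (Φ i _ z) ((hnat S.g i z).trans (by
    rw [show (((tensorBimod k A B C).obj L).map S.g).hom.hom z = 0 from hz, map_zero]))
  refine ⟨∑ i, tmul L S.X₁ (x i) (y i), ?_⟩
  refine (map_sum (((tensorBimod k A B C).obj L).map S.f).hom.hom _ _).trans
    ((Finset.sum_congr rfl fun i _ => ?_).trans (hsum S.X₂ z))
  exact congrArg (fun w => tmul L S.X₂ (x i) w) (hy i)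

/-- For X = A ⊗ Bᵒᵖ the tensor product X ⊗_B M is A ⊗_k M, free over A on a k-basis of M. In
general, a dual basis of `X` is combined with a k-basis of `M`, and no projectivity of `M` is
needed. -/
theorem isProjAlong_includeLeft_tensorObj {X : FGBimod k A B} (hX : IsProjAlong (AlgHom.id k _) X)
    (M : FGBimod k B C) :
    IsProjAlong (Algebra.TensorProduct.includeLeft : A →ₐ[k] A ⊗[k] Cᵐᵒᵖ) (tensorObj X M) := by
  obtain ⟨ι, _, x, χ, hχ, hx⟩ := hX
  simp only [AlgHom.id_apply] at hχ hx
  let e := Module.finBasis k M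
  let act : B →ₗ[k] M →ₗ[k] M := ((Algebra.lsmul k k M).comp
      (Algebra.TensorProduct.includeLeft : B →ₐ[k] B ⊗[k] Cᵐᵒᵖ)).toLinearMap
  -- The `j`-th coordinate of (a ⊗ b) ⊗ m, seen as a ⊗ bm in A ⊗_k M.
  let θ (j) : A ⊗[k] Bᵐᵒᵖ →ₗ[k] M →ₗ[k] A := TensorProduct.lift (LinearMap.mk₂ k
    (fun a b => LinearMap.smulRight (e.coord j ∘ₗ act b.unop) a)
    (fun a a' b => by ext; simp) (fun c a b => by ext; simp [smul_comm _ c])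
    (fun a b b' => by ext; simp [add_smul]) (fun c a b => by ext; simp [mul_smul]))
  have hθ (j a b m) : θ j (a ⊗ₜ b) m = e.coord j ((b.unop ⊗ₜ[k] (1 : Cᵐᵒᵖ)) • m) • a := rfl
  have hθl (j a r m) : θ j ((a ⊗ₜ (1 : Bᵐᵒᵖ)) * r) m = a * θ j r m := by
    induction r using TensorProduct.induction_on with
    | zero => simp
    | add r s hr hs => simp only [mul_add, map_add, LinearMap.add_apply, hr, hs]
    | tmul a' b => simp [hθ]
  have hθr (j b r m) : θ j (((1 : A) ⊗ₜ MulOpposite.op b) * r) m =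
      θ j r ((b ⊗ₜ[k] (1 : Cᵐᵒᵖ)) • m) := by
    induction r using TensorProduct.induction_on with
    | zero => simp
    | add r s hr hs => simp only [mul_add, map_add, LinearMap.add_apply, hr, hs]
    | tmul a' b => simp [hθ, smul_smul]
  -- The dual basis identity for the free module, transported along r ↦ r y: move b across the
  -- tensor sign and expand bm in the basis `e`.
  have hθs (r) (y : X) (m) : ∑ j, (θ j r m ⊗ₜ[k] (1 : Cᵐᵒᵖ)) • tmul X M y (e j) =
      tmul X M (r • y) m := by
    induction r using TensorProduct.induction_on with
    | zero =>
      simp [← tmulₗ_apply, zero_smul_bimod]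
    | add r s hr hs =>
      simp only [map_add, LinearMap.add_apply, TensorProduct.add_tmul, add_smul,
        Finset.sum_add_distrib, hr, hs, add_tmul]
    | tmul a b =>
      have h : a ⊗ₜ[k] b = ((1 : A) ⊗ₜ[k] b) * (a ⊗ₜ[k] (1 : Bᵐᵒᵖ)) := by simp
      have h' := tmul_balanced X M ((a ⊗ₜ[k] (1 : Bᵐᵒᵖ)) • y) b.unop m
      rw [MulOpposite.op_unop, smul_smul, ← h] at h'
      rw [h', ← e.sum_repr ((b.unop ⊗ₜ[k] (1 : Cᵐᵒᵖ)) • m), ← tmulₗ_apply, map_sum]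
      refine Finset.sum_congr rfl fun j _ => ?_
      rw [map_smul, hθ, ← TensorProduct.smul_tmul', smul_assoc, tmulₗ_apply, smul_left_tmul]
      rfl
  refine ⟨ι × Fin (Module.finrank k M), inferInstance, fun a => tmul X M (x a.1) (e a.2),
    fun a => tensorLift ((θ a.2).comp (χ a.1)) fun l b m => by simp [hχ, hθr], ?_, ?_⟩
  · intro a s y
    induction y using tensor_induction with
    | hz => simp
    | ht l m => simp [smul_left_tmul, hχ, hθl]
    | ha y z hy hz => simp only [smul_add, map_add, hy, hz, mul_add]
  · intro y
    induction y using tensor_induction with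
    | hz => simp [zero_smul_bimod]
    | ht l m =>
      rw [Fintype.sum_prod_type]
      simp only [tensorLift_tmul, LinearMap.comp_apply, Algebra.TensorProduct.includeLeft_apply,
        hθs]
      conv_rhs => rw [← hx l]
      simp [← tmulₗ_apply, map_sum, LinearMap.sum_apply]
    | ha y z hy hz =>
      conv_rhs => rw [← hy, ← hz]
      simp only [map_add, add_smul, Finset.sum_add_distrib]

/-- The mirror image: L ⊗_B (B ⊗ Cᵒᵖ) is L ⊗_k Cᵒᵖ, free over Cᵒᵖ on a k-basis of `L`. -/
theorem isProjAlong_includeRight_tensorObj (L : FGBimod k A B) {X : FGBimod k B C}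
    (hX : IsProjAlong (AlgHom.id k _) X) :
    IsProjAlong (Algebra.TensorProduct.includeRight : Cᵐᵒᵖ →ₐ[k] A ⊗[k] Cᵐᵒᵖ) (tensorObj L X) := by
  obtain ⟨ι, _, x, χ, hχ, hx⟩ := hX
  simp only [AlgHom.id_apply] at hχ hx
  let e := Module.finBasis k L
  let act : Bᵐᵒᵖ →ₗ[k] L →ₗ[k] L := ((Algebra.lsmul k k L).comp
      (Algebra.TensorProduct.includeRight : Bᵐᵒᵖ →ₐ[k] A ⊗[k] Bᵐᵒᵖ)).toLinearMap
  let θ (j) : B ⊗[k] Cᵐᵒᵖ →ₗ[k] L →ₗ[k] Cᵐᵒᵖ := TensorProduct.lift (LinearMap.mk₂ k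
    (fun b c => LinearMap.smulRight (e.coord j ∘ₗ act (MulOpposite.op b)) c)
    (fun b b' c => by ext; simp [add_smul]) (fun r b c => by ext; simp [mul_smul])
    (fun b c c' => by ext; simp) (fun r b c => by ext; simp [smul_comm _ r]))
  have hθ (j b c l) : θ j (b ⊗ₜ c) l =
      e.coord j (((1 : A) ⊗ₜ[k] MulOpposite.op b) • l) • c := rfl
  have hθr (j c r l) : θ j (((1 : B) ⊗ₜ c) * r) l = c * θ j r l := by
    induction r using TensorProduct.induction_on with
    | zero => simp
    | add r s hr hs => simp only [mul_add, map_add, LinearMap.add_apply, hr, hs]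
    | tmul a' b => simp [hθ]
  have hθl (j b r l) : θ j ((b ⊗ₜ (1 : Cᵐᵒᵖ)) * r) l =
      θ j r (((1 : A) ⊗ₜ[k] MulOpposite.op b) • l) := by
    induction r using TensorProduct.induction_on with
    | zero => simp
    | add r s hr hs => simp only [mul_add, map_add, LinearMap.add_apply, hr, hs]
    | tmul a' b => simp [hθ, smul_smul]
  have hθs (r) (y : X) (l) : ∑ j, ((1 : A) ⊗ₜ[k] θ j r l) • tmul L X (e j) y =
      tmul L X l (r • y) := by
    induction r using TensorProduct.induction_on with
    | zero =>
      simp [← tmulₗ_apply, zero_smul_bimod]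
    | add r s hr hs =>
      simp only [map_add, LinearMap.add_apply, TensorProduct.tmul_add, add_smul,
        Finset.sum_add_distrib, hr, hs, tmul_add]
    | tmul b c =>
      have h : b ⊗ₜ[k] c = (b ⊗ₜ[k] (1 : Cᵐᵒᵖ)) * ((1 : B) ⊗ₜ[k] c) := by simp
      have h' := tmul_balanced L X l b (((1 : B) ⊗ₜ[k] c) • y)
      rw [smul_smul, ← h] at h'
      rw [← h', ← e.sum_repr (((1 : A) ⊗ₜ[k] MulOpposite.op b) • l), ← tmulₗ_apply, map_sum,
        LinearMap.sum_apply]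
      refine Finset.sum_congr rfl fun j _ => ?_
      rw [map_smul (tmulₗ L X), LinearMap.smul_apply, hθ, TensorProduct.tmul_smul, smul_assoc,
        tmulₗ_apply, smul_right_tmul]
      rfl
  let Φ (a : ι × Fin (Module.finrank k L)) : tensorObj L X →ₗ[k] Cᵐᵒᵖ :=
    tensorLift ((θ a.2).comp (χ a.1)).flip fun l b m => by simp [hχ, hθl]
  have hΦ (a l p) : Φ a (tmul L X l p) = θ a.2 (χ a.1 p) l := rfl
  refine ⟨ι × Fin (Module.finrank k L), inferInstance, fun a => tmul L X (e a.2) (x a.1), Φ,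
    ?_, ?_⟩
  · intro a s y
    induction y using tensor_induction with
    | hz => simp
    | ht l m => simp [smul_right_tmul, hΦ, hχ, hθr]
    | ha y z hy hz => simp only [smul_add, map_add, hy, hz, mul_add]
  · intro y
    induction y using tensor_induction with
    | hz => simp [zero_smul_bimod]
    | ht l m =>
      rw [Fintype.sum_prod_type]
      simp only [hΦ, Algebra.TensorProduct.includeRight_apply, hθs]
      conv_rhs => rw [← hx m]
      simp [← tmulₗ_apply, map_sum]
    | ha y z hy hz =>
      conv_rhs => rw [← hy, ← hz]
      simp only [map_add, add_smul, Finset.sum_add_distrib]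

end Exactness

end TensorAPI

/-! ### Tensoring quasi-isomorphisms of one-sided projective complexes -/

section Contractions

variable {k A B C : Type u} [Field k] [Ring A] [Algebra k A] [Ring B] [Algebra k B]
  [Ring C] [Algebra k C]
  [FiniteDimensional k A] [FiniteDimensional k B] [FiniteDimensional k C]

/-- The cone is contractible by right B-linear maps. They need not be bimodule maps, but they still
act on the tensor product with `M` as k-linear maps, and acyclicity only concerns elements. -/
theorem quasiIso_tensor_right {K L : CochainComplex (FGBimod k A B) ℤ} (f : K ⟶ L) [QuasiIso f]
    (hK : ∀ n, IsProjAlong (Algebra.TensorProduct.includeRight : Bᵐᵒᵖ →ₐ[k] A ⊗[k] Bᵐᵒᵖ) (K.X n))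
    (hL : ∀ n, IsProjAlong (Algebra.TensorProduct.includeRight : Bᵐᵒᵖ →ₐ[k] A ⊗[k] Bᵐᵒᵖ) (L.X n))
    (N : ℤ) [K.IsStrictlyLE N] [L.IsStrictlyLE N] (M : FGBimod k B C) :
    QuasiIso ((((tensorBimod k A B C).flip.obj M).mapHomologicalComplex (ComplexShape.up ℤ)).map
      f) := by
  refine quasiIso_map_of_acyclic_mappingCone _ f fun j => ?_
  obtain ⟨s, t, hs, ht, hst⟩ := exists_contraction (CochainComplex.mappingCone f)
    ((quasiIso_iff_acyclic_mappingCone f).1 inferInstance) (isProjAlong_mappingCone f hK hL) N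
    (isStrictlyLE_mappingCone f N) (j - 1) j (j + 1) (by lia) rfl
  simp only [Algebra.TensorProduct.includeRight_apply] at hs ht
  generalize CochainComplex.mappingCone f = E at *
  rw [fgModuleCat_exactAt_iff _ (j - 1) j (j + 1) (by lia) rfl]
  have h (z : tensorObj (E.X j) M) :
      (((tensorBimod k A B C).map (E.d (j - 1) j)).app M).hom.hom (tensorMapLeft s hs M z) +
      tensorMapLeft t ht M ((((tensorBimod k A B C).map (E.d j (j + 1))).app M).hom.hom z) = z := by
    induction z using tensor_induction with
    | hz => simp
    | ht l m =>
      refine Eq.trans ?_ (congrArg (fun l => tmul (E.X j) M l m) (hst l))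
      exact (add_tmul _ _ _ _ _).symm
    | ha x y hx hy =>
      conv_rhs => rw [← hx, ← hy]
      simp only [map_add]
      abel
  intro z hz
  refine ⟨tensorMapLeft s hs M z, Eq.trans ?_ (h z)⟩
  rw [show (((tensorBimod k A B C).map (E.d j (j + 1))).app M).hom.hom z = 0 from hz, map_zero,
    add_zero]
  rfl

theorem quasiIso_tensor_left {K L : CochainComplex (FGBimod k B C) ℤ} (f : K ⟶ L) [QuasiIso f]
    (hK : ∀ n, IsProjAlong (Algebra.TensorProduct.includeLeft : B →ₐ[k] B ⊗[k] Cᵐᵒᵖ) (K.X n))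
    (hL : ∀ n, IsProjAlong (Algebra.TensorProduct.includeLeft : B →ₐ[k] B ⊗[k] Cᵐᵒᵖ) (L.X n))
    (N : ℤ) [K.IsStrictlyLE N] [L.IsStrictlyLE N] (M : FGBimod k A B) :
    QuasiIso ((((tensorBimod k A B C).obj M).mapHomologicalComplex (ComplexShape.up ℤ)).map
      f) := by
  refine quasiIso_map_of_acyclic_mappingCone _ f fun j => ?_
  obtain ⟨s, t, hs, ht, hst⟩ := exists_contraction (CochainComplex.mappingCone f)
    ((quasiIso_iff_acyclic_mappingCone f).1 inferInstance) (isProjAlong_mappingCone f hK hL) N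
    (isStrictlyLE_mappingCone f N) (j - 1) j (j + 1) (by lia) rfl
  simp only [Algebra.TensorProduct.includeLeft_apply] at hs ht
  generalize CochainComplex.mappingCone f = E at *
  rw [fgModuleCat_exactAt_iff _ (j - 1) j (j + 1) (by lia) rfl]
  have h (z : tensorObj M (E.X j)) :
      (((tensorBimod k A B C).obj M).map (E.d (j - 1) j)).hom.hom (tensorMapRight s hs M z) +
      tensorMapRight t ht M ((((tensorBimod k A B C).obj M).map (E.d j (j + 1))).hom.hom z) = z := by
    induction z using tensor_induction with
    | hz => simp
    | ht m l =>
      refine Eq.trans ?_ (congrArg (fun l => tmul M (E.X j) m l) (hst l))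
      exact (tmul_add _ _ _ _ _).symm
    | ha x y hx hy =>
      conv_rhs => rw [← hx, ← hy]
      simp only [map_add]
      abel
  intro z hz
  refine ⟨tensorMapRight s hs M z, Eq.trans ?_ (h z)⟩
  rw [show (((tensorBimod k A B C).obj M).map (E.d j (j + 1))).hom.hom z = 0 from hz, map_zero,
    add_zero]
  rfl

end Contractions

/-! ### The regular bimodule as a unit -/

section Unit

variable (k A B C : Type u) [Field k] [Ring A] [Algebra k A] [Ring B] [Algebra k B]
  [Ring C] [Algebra k C]
  [FiniteDimensional k A] [FiniteDimensional k B] [FiniteDimensional k C]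

/-- The algebra `B` as a bimodule over itself. -/
def regularBimod : FGBimod k B B :=
  letI : Module (B ⊗[k] Bᵐᵒᵖ) B := TensorProduct.Algebra.module
  haveI : IsScalarTower k (B ⊗[k] Bᵐᵒᵖ) B := ⟨fun c r x => by
    induction r using TensorProduct.induction_on with
    | zero =>
      have h : (0 : B ⊗[k] Bᵐᵒᵖ) • x = 0 := Module.zero_smul x
      rw [smul_zero, h, smul_zero]
    | add r s hr hs => rw [smul_add, add_smul, add_smul, smul_add, hr, hs]
    | tmul b c' =>
      rw [TensorProduct.smul_tmul', TensorProduct.Algebra.smul_def,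
        TensorProduct.Algebra.smul_def, smul_assoc]⟩
  haveI : Module.Finite (B ⊗[k] Bᵐᵒᵖ) B := Module.Finite.of_restrictScalars_finite k _ _
  FGModuleCat.of (B ⊗[k] Bᵐᵒᵖ) B

variable {k B}

theorem smul_regularBimod (a : B) (c : Bᵐᵒᵖ) (b : B) :
    (a ⊗ₜ[k] c) • (show regularBimod k B from b) = show regularBimod k B from a * (b * c.unop) :=
  rfl

/-- The regular bimodule is the algebra, as a vector space. -/
def regularEquiv : B ≃ₗ[k] regularBimod k B where
  toFun b := b
  invFun b := b
  map_add' _ _ := rfl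
  map_smul' c b := by
    refine Eq.trans ?_ (smul_regularBimod (algebraMap k B c) 1 b).symm
    exact ((Algebra.smul_def c b).trans
      (congrArg (algebraMap k B c * ·) (mul_one b).symm))

theorem smul_regularEquiv (a : B) (c : Bᵐᵒᵖ) (b : B) :
    (a ⊗ₜ[k] c) • regularEquiv (k := k) b = regularEquiv (a * (b * c.unop)) := rfl

theorem regularEquiv_symm_smul (a : B) (c : Bᵐᵒᵖ) (b : regularBimod k B) :
    regularEquiv.symm ((a ⊗ₜ[k] c) • b) = a * (regularEquiv.symm b * c.unop) := rfl

/-- One-sidedly B is free on 1. This makes the cone of P_B → B one-sidedly contractible, though B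
need not be projective as a bimodule. -/
theorem isProjAlong_includeLeft_regularBimod :
    IsProjAlong (Algebra.TensorProduct.includeLeft : B →ₐ[k] B ⊗[k] Bᵐᵒᵖ) (regularBimod k B) := by
  refine ⟨Unit, inferInstance, fun _ => regularEquiv 1, fun _ => regularEquiv.symm.toLinearMap,
    fun _ s y => ?_, fun y => ?_⟩
  · simp [regularEquiv_symm_smul]
  · simp [smul_regularEquiv]

theorem isProjAlong_includeRight_regularBimod :
    IsProjAlong (Algebra.TensorProduct.includeRight : Bᵐᵒᵖ →ₐ[k] B ⊗[k] Bᵐᵒᵖ)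
      (regularBimod k B) := by
  refine ⟨Unit, inferInstance, fun _ => regularEquiv 1,
    fun _ => (MulOpposite.opLinearEquiv k).toLinearMap.comp regularEquiv.symm.toLinearMap,
    fun _ s y => ?_, fun y => ?_⟩
  · simp [regularEquiv_symm_smul]
  · simp [smul_regularEquiv]

variable (M : FGBimod k B C) (L : FGBimod k A B)

/-- The isomorphism `B ⊗_B M ≅ M`. -/
def tensorLeftUnitor : tensorObj (regularBimod k B) M ≅ M where
  hom := bimodHom (tensorLift (((Algebra.lsmul k k M).comp
      (Algebra.TensorProduct.includeLeft : B →ₐ[k] B ⊗[k] Cᵐᵒᵖ)).toLinearMap.comp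
        regularEquiv.symm.toLinearMap)
      fun b c m => by simp [regularEquiv_symm_smul, smul_smul])
    (fun b x => by
      induction x using tensor_induction with
      | hz => simp
      | ht c m => simp [smul_left_tmul, regularEquiv_symm_smul, smul_smul]
      | ha x y hx hy => simp only [smul_add, map_add, hx, hy])
    (fun b x => by
      induction x using tensor_induction with
      | hz => simp
      | ht c m => simp [smul_right_tmul, smul_smul]
      | ha x y hx hy => simp only [smul_add, map_add, hx, hy])
  inv := bimodHom (tmulₗ (regularBimod k B) M (regularEquiv 1))
    (fun b x => by
      simp only [tmulₗ_apply, ← tmul_balanced, smul_left_tmul, smul_regularEquiv]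
      simp)
    (fun b x => by simp only [tmulₗ_apply, smul_right_tmul])
  hom_inv_id := by
    refine tensorObj_hom_ext fun b m => ?_
    change tmul (regularBimod k B) M (regularEquiv 1)
      ((regularEquiv.symm b ⊗ₜ[k] (1 : Cᵐᵒᵖ)) • m) = tmul (regularBimod k B) M b m
    rw [← tmul_balanced, smul_regularEquiv]
    simp
  inv_hom_id := by
    refine FGModuleCat.hom_ext (LinearMap.ext fun m => ?_)
    change (regularEquiv.symm (regularEquiv (1 : B)) ⊗ₜ[k] (1 : Cᵐᵒᵖ)) • m = m
    rw [LinearEquiv.symm_apply_apply, ← Algebra.TensorProduct.one_def, one_smul]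

/-- The isomorphism `L ⊗_B B ≅ L`. -/
def tensorRightUnitor : tensorObj L (regularBimod k B) ≅ L where
  hom := bimodHom (tensorLift (((Algebra.lsmul k k L).comp
      (Algebra.TensorProduct.includeRight : Bᵐᵒᵖ →ₐ[k] A ⊗[k] Bᵐᵒᵖ)).toLinearMap.comp
        ((MulOpposite.opLinearEquiv k).toLinearMap.comp regularEquiv.symm.toLinearMap)).flip
      fun b c m => by simp [regularEquiv_symm_smul, smul_smul])
    (fun b x => by
      induction x using tensor_induction with
      | hz => simp
      | ht c m => simp [smul_left_tmul, smul_smul]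
      | ha x y hx hy => simp only [smul_add, map_add, hx, hy])
    (fun b x => by
      induction x using tensor_induction with
      | hz => simp
      | ht c m => simp [smul_right_tmul, regularEquiv_symm_smul, smul_smul]
      | ha x y hx hy => simp only [smul_add, map_add, hx, hy])
  inv := bimodHom ((tmulₗ L (regularBimod k B)).flip (regularEquiv 1))
    (fun b x => by simp only [LinearMap.flip_apply, tmulₗ_apply, smul_left_tmul])
    (fun b x => by
      have h := tmul_balanced L (regularBimod k B) x b.unop (regularEquiv 1)
      rw [MulOpposite.op_unop] at h
      simp only [LinearMap.flip_apply, tmulₗ_apply, h, smul_right_tmul, smul_regularEquiv]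
      simp)
  hom_inv_id := by
    refine tensorObj_hom_ext fun l b => ?_
    change tmul L (regularBimod k B) (((1 : A) ⊗ₜ[k] MulOpposite.op (regularEquiv.symm b)) • l)
      (regularEquiv 1) = tmul L (regularBimod k B) l b
    rw [tmul_balanced, smul_regularEquiv]
    simp
  inv_hom_id := by
    refine FGModuleCat.hom_ext (LinearMap.ext fun m => ?_)
    change ((1 : A) ⊗ₜ[k] MulOpposite.op (regularEquiv.symm (regularEquiv (1 : B)))) • m = m
    rw [LinearEquiv.symm_apply_apply, MulOpposite.op_one, ← Algebra.TensorProduct.one_def, one_smul]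

variable (k B)

/-- The natural isomorphism `B ⊗_B M ≅ M`. -/
def tensorLeftUnitorIso : (tensorBimod k B B C).obj (regularBimod k B) ≅ 𝟭 _ :=
  NatIso.ofComponents (fun M => tensorLeftUnitor C M) fun f =>
    tensorObj_hom_ext fun _ _ => (map_smul f.hom.hom _ _).symm

/-- The natural isomorphism `L ⊗_B B ≅ L`. -/
def tensorRightUnitorIso : (tensorBimod k A B B).flip.obj (regularBimod k B) ≅ 𝟭 _ :=
  NatIso.ofComponents (fun L => tensorRightUnitor A L) fun f =>
    tensorObj_hom_ext fun _ _ => (map_smul f.hom.hom _ _).symm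

end Unit

/-! ### The associator for bimodules -/

section Associator

variable {k A B C D : Type u} [Field k] [Ring A] [Algebra k A] [Ring B] [Algebra k B]
  [Ring C] [Algebra k C] [Ring D] [Algebra k D]
  [FiniteDimensional k A] [FiniteDimensional k B] [FiniteDimensional k C] [FiniteDimensional k D]
  (L : FGBimod k A B) (M : FGBimod k B C) (N : FGBimod k C D)

/-- The map `(l ⊗ m) ⊗ n ↦ l ⊗ (m ⊗ n)`. -/
def tensorAssocHom : tensorObj (tensorObj L M) N →ₗ[k] tensorObj L (tensorObj M N) :=
  tensorLift (tensorLift (LinearMap.mk₂ k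
      (fun l m => (tmulₗ L (tensorObj M N) l).comp (tmulₗ M N m))
      (fun l l' m => by ext; simp) (fun c l m => by ext; simp)
      (fun l m m' => by ext; simp) (fun c l m => by ext; simp))
      fun l b m => by
        ext n
        simp [tmulₗ_apply, tmul_balanced, smul_left_tmul])
    fun x c n => by
      induction x using tensor_induction with
      | hz => simp
      | ht l m => simp [smul_right_tmul, tmulₗ_apply, tmul_balanced]
      | ha x y hx hy => simp only [smul_add, map_add, LinearMap.add_apply, hx, hy]

theorem tensorAssocHom_tmul (l : L) (m : M) (n : N) :
    tensorAssocHom L M N (tmul _ N (tmul L M l m) n) = tmul L _ l (tmul M N m n) := rfl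

/-- The map `l ⊗ (m ⊗ n) ↦ (l ⊗ m) ⊗ n`. -/
def tensorAssocInv : tensorObj L (tensorObj M N) →ₗ[k] tensorObj (tensorObj L M) N :=
  tensorLift (tensorLift (LinearMap.mk₂ k
      (fun m n => ((tmulₗ (tensorObj L M) N).flip n).comp ((tmulₗ L M).flip m))
      (fun l l' m => by ext; simp) (fun c l m => by ext; simp)
      (fun l m m' => by ext; simp) (fun c l m => by ext; simp))
      fun m c n => by
        ext l
        simp [tmulₗ_apply, ← tmul_balanced, smul_right_tmul]).flip
    fun l b x => by
      induction x using tensor_induction with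
      | hz => simp
      | ht m n => simp [smul_left_tmul, tmulₗ_apply, tmul_balanced]
      | ha x y hx hy => simp only [smul_add, map_add, hx, hy]

theorem tensorAssocInv_tmul (l : L) (m : M) (n : N) :
    tensorAssocInv L M N (tmul L _ l (tmul M N m n)) = tmul _ N (tmul L M l m) n := rfl

theorem tensor_induction_left {p : tensorObj (tensorObj L M) N → Prop} (hz : p 0)
    (ht : ∀ l m n, p (tmul _ N (tmul L M l m) n)) (ha : ∀ x y, p x → p y → p (x + y)) (x) : p x := by
  induction x using tensor_induction with
  | hz => exact hz
  | ha x y hx hy => exact ha x y hx hy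
  | ht x n =>
    induction x using tensor_induction with
    | hz => simpa [← tmulₗ_apply] using hz
    | ht l m => exact ht l m n
    | ha x y hx hy => exact add_tmul _ N x y n ▸ ha _ _ hx hy

theorem tensor_induction_right {p : tensorObj L (tensorObj M N) → Prop} (hz : p 0)
    (ht : ∀ l m n, p (tmul L _ l (tmul M N m n))) (ha : ∀ x y, p x → p y → p (x + y)) (x) : p x := by
  induction x using tensor_induction with
  | hz => exact hz
  | ha x y hx hy => exact ha x y hx hy
  | ht l x =>
    induction x using tensor_induction with
    | hz => simpa [← tmulₗ_apply] using hz
    | ht m n => exact ht l m n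
    | ha x y hx hy => exact tmul_add L _ l x y ▸ ha _ _ hx hy

/-- The associativity isomorphism of the tensor product of bimodules. -/
def tensorAssoc : tensorObj (tensorObj L M) N ≅ tensorObj L (tensorObj M N) where
  hom := bimodHom (tensorAssocHom L M N)
    (fun a x => by
      induction x using tensor_induction_left with
      | hz => simp
      | ht l m n => simp only [smul_left_tmul, tensorAssocHom_tmul]
      | ha x y hx hy => simp only [smul_add, map_add, hx, hy])
    (fun a x => by
      induction x using tensor_induction_left with
      | hz => simp
      | ht l m n => simp only [smul_right_tmul, tensorAssocHom_tmul]
      | ha x y hx hy => simp only [smul_add, map_add, hx, hy])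
  inv := bimodHom (tensorAssocInv L M N)
    (fun a x => by
      induction x using tensor_induction_right with
      | hz => simp
      | ht l m n => simp only [smul_left_tmul, tensorAssocInv_tmul]
      | ha x y hx hy => simp only [smul_add, map_add, hx, hy])
    (fun a x => by
      induction x using tensor_induction_right with
      | hz => simp
      | ht l m n => simp only [smul_right_tmul, tensorAssocInv_tmul]
      | ha x y hx hy => simp only [smul_add, map_add, hx, hy])
  hom_inv_id := by
    refine FGModuleCat.hom_ext (LinearMap.ext fun x => ?_)
    change tensorAssocInv L M N (tensorAssocHom L M N x) = x
    induction x using tensor_induction_left with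
    | hz => simp
    | ht l m n => rfl
    | ha x y hx hy => simp only [map_add, hx, hy]
  inv_hom_id := by
    refine FGModuleCat.hom_ext (LinearMap.ext fun x => ?_)
    change tensorAssocHom L M N (tensorAssocInv L M N x) = x
    induction x using tensor_induction_right with
    | hz => simp
    | ht l m n => rfl
    | ha x y hx hy => simp only [map_add, hx, hy]

variable {L M N} in
theorem tensorObj_tensorObj_hom_ext {Z : FGBimod k A D} {f g : tensorObj (tensorObj L M) N ⟶ Z}
    (h : ∀ l m n, f.hom.hom (tmul _ N (tmul L M l m) n) = g.hom.hom (tmul _ N (tmul L M l m) n)) :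
    f = g := by
  refine FGModuleCat.hom_ext (LinearMap.ext fun x => ?_)
  induction x using tensor_induction_left with
  | hz => exact (map_zero f.hom.hom).trans (map_zero g.hom.hom).symm
  | ht l m n => exact h l m n
  | ha x y hx hy =>
    exact (map_add f.hom.hom x y).trans ((congrArg₂ (· + ·) hx hy).trans
      (map_add g.hom.hom x y).symm)

variable (k A B C D) in
/-- The associativity isomorphism of the tensor product of bimodules, naturally in all three
variables. -/
def tensorAssocIso : bifunctorComp₁₂ (tensorBimod k A B C) (tensorBimod k A C D) ≅
    bifunctorComp₂₃ (tensorBimod k A B D) (tensorBimod k B C D) :=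
  NatIso.ofComponents (fun L => NatIso.ofComponents (fun M => NatIso.ofComponents
    (fun N => tensorAssoc L M N)
    (fun f => tensorObj_tensorObj_hom_ext fun _ _ _ => rfl))
    (fun f => by ext N : 2; exact tensorObj_tensorObj_hom_ext fun _ _ _ => rfl))
    (fun f => by ext M N : 4; exact tensorObj_tensorObj_hom_ext fun _ _ _ => rfl)

end Associator

/-! ### The unit isomorphism for complexes -/

section Unitors

open HomologicalComplex

variable {𝒜 ℬ : Type*} [Category* 𝒜] [Category* ℬ] [Preadditive 𝒜] [Preadditive ℬ]
  [HasZeroObject 𝒜] [HasFiniteCoproducts ℬ]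

/-- The complex with the object `X` in degree zero. -/
def singleCMinus (X : 𝒜) : CMinus 𝒜 :=
  ⟨(CochainComplex.singleFunctor 𝒜 0).obj X, 0, inferInstance⟩

theorem isZero_singleCMinus_X (X : 𝒜) (p : ℤ) (hp : p ≠ 0) : IsZero ((singleCMinus X).obj.X p) :=
  isZero_single_obj_X (ComplexShape.up ℤ) 0 X p hp

/-- The object in degree zero of the complex with `X` in degree zero. -/
def singleCMinusXZero (X : 𝒜) : (singleCMinus X).obj.X 0 ≅ X :=
  singleObjXSelf (ComplexShape.up ℤ) 0 X

theorem singleCMinus_d (X : 𝒜) (p q : ℤ) : (singleCMinus X).obj.d p q = 0 :=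
  single_obj_d (ComplexShape.up ℤ) 0 X p q

variable (F : 𝒜 ⥤ ℬ ⥤ ℬ) [F.Additive] [∀ X, (F.obj X).Additive] {X : 𝒜} (e : F.obj X ≅ 𝟭 ℬ)

/-- The inverse of the unit isomorphism `F (X[0], K) ≅ K`, in each degree. -/
def unitorInvDegree (K : CMinus ℬ) (n : ℤ) : K.obj.X n ⟶
    (mapBifunctor (singleCMinus X).obj K.obj F (ComplexShape.up ℤ)).X n :=
  e.inv.app (K.obj.X n) ≫ (F.map (singleCMinusXZero X).inv).app (K.obj.X n) ≫
    ιMapBifunctor (singleCMinus X).obj K.obj F (ComplexShape.up ℤ) 0 n n (zero_add n)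

/-- The complex `X[0]` has zero differential, and the sign of the vertical differential in column 0
is (-1)^0 = 1. -/
theorem unitorInvDegree_comm (K : CMinus ℬ) (n n' : ℤ) (h : n + 1 = n') :
    unitorInvDegree F e K n ≫
      (mapBifunctor (singleCMinus X).obj K.obj F (ComplexShape.up ℤ)).d n n' =
      K.obj.d n n' ≫ unitorInvDegree F e K n' := by
  have hd : mapBifunctor.d₁ (singleCMinus X).obj K.obj F (ComplexShape.up ℤ) 0 n n' = 0 := by
    rw [mapBifunctor.d₁_eq _ _ _ _ (show (ComplexShape.up ℤ).Rel 0 1 from rfl) _ _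
      (show 1 + n = n' by lia), singleCMinus_d]
    simp
  rw [unitorInvDegree, unitorInvDegree, Category.assoc, Category.assoc, mapBifunctor.d_eq,
    Preadditive.comp_add, mapBifunctor.ι_D₁, mapBifunctor.ι_D₂, hd, zero_add,
    mapBifunctor.d₂_eq _ _ _ _ _ (show (ComplexShape.up ℤ).Rel n n' from h) _
      (show 0 + n' = n' by lia)]
  trans e.inv.app (K.obj.X n) ≫ (F.map (singleCMinusXZero X).inv).app (K.obj.X n) ≫
    ((1 : ℤˣ) • (F.obj ((singleCMinus X).obj.X 0)).map (K.obj.d n n') ≫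
      ιMapBifunctor (singleCMinus X).obj K.obj F (ComplexShape.up ℤ) 0 n' n' (zero_add n') : _ ⟶ _)
  · rfl
  · rw [one_smul, ← NatTrans.naturality_assoc, ← NatTrans.naturality_assoc]
    rfl

instance (K : CMinus ℬ) (n : ℤ) : IsIso (unitorInvDegree F e K n) := by
  have hX (Y : ℬ) : (F.map (singleCMinusXZero X).inv).app Y ≫
      (F.map (singleCMinusXZero X).hom).app Y = 𝟙 _ := by
    rw [← NatTrans.comp_app, ← F.map_comp, Iso.inv_hom_id, F.map_id, NatTrans.id_app]
  have hX' (Y : ℬ) : (F.map (singleCMinusXZero X).hom).app Y ≫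
      (F.map (singleCMinusXZero X).inv).app Y = 𝟙 _ := by
    rw [← NatTrans.comp_app, ← F.map_comp, Iso.hom_inv_id, F.map_id, NatTrans.id_app]
  -- The inverse is the projection to column 0, all other columns being zero.
  refine ⟨totalProj F (singleCMinus X) K n 0 ≫ (F.map (singleCMinusXZero X).hom).app _ ≫
    e.hom.app _ ≫ (K.obj.XIsoOfEq (by lia)).hom, ?_, ?_⟩
  · have h := ι_totalProj (F := F) (singleCMinus X) K n 0 n (zero_add n)
    have := e.hom.naturality (K.obj.XIsoOfEq (show n = n - 0 by lia)).hom
    rw [unitorInvDegree, Category.assoc, Category.assoc, reassoc_of% h, NatTrans.naturality_assoc,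
      reassoc_of% hX, reassoc_of% this]
    simp
  · refine mapBifunctor.hom_ext fun p q h => ?_
    change p + q = n at h
    by_cases hp : p = 0
    · subst hp
      obtain rfl : q = n := by lia
      have h := ι_totalProj (F := F) (singleCMinus X) K q 0 q (zero_add q)
      simp only [Category.assoc]
      rw [reassoc_of% h, NatTrans.naturality_assoc]
      have := e.hom.naturality (K.obj.XIsoOfEq (show q = q - 0 by lia)).hom
      rw [reassoc_of% this, unitorInvDegree]
      simp [reassoc_of% hX']
    · exact (isZero_bifunctor_left F (isZero_singleCMinus_X X p hp) _).eq_of_src _ _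

/-- The inverse of the unit isomorphism `F (X[0], K) ≅ K`. -/
def unitorInv (K : CMinus ℬ) : K.obj ⟶
    mapBifunctor (singleCMinus X).obj K.obj F (ComplexShape.up ℤ) where
  f n := unitorInvDegree F e K n
  comm' n n' h := unitorInvDegree_comm F e K n n' h

instance (K : CMinus ℬ) : IsIso (unitorInv F e K) :=
  have (n : ℤ) : IsIso ((unitorInv F e K).f n) :=
    inferInstanceAs (IsIso (unitorInvDegree F e K n))
  HomologicalComplex.Hom.isIso_of_components _

/-- The unit isomorphism for a single complex. -/
def unitorIso (K : CMinus ℬ) : K.obj ≅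
    mapBifunctor (singleCMinus X).obj K.obj F (ComplexShape.up ℤ) :=
  asIso (unitorInv F e K)

/-- The unit isomorphism `F (X[0], K) ≅ K` when `F (X, -)` is isomorphic to the identity. -/
def unitorCMinus : (mapBifunctorCMinus F).obj (singleCMinus X) ≅ 𝟭 (CMinus ℬ) :=
  (NatIso.ofComponents (fun K => (boundedAbove ℬ).isoMk (unitorIso F e K))
    fun {K K'} f => by
      refine ObjectProperty.hom_ext _ (HomologicalComplex.hom_ext _ _ fun n => ?_)
      change f.hom.f n ≫ unitorInvDegree F e K' n = unitorInvDegree F e K n ≫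
        (mapBifunctorMap (𝟙 (singleCMinus X).obj) f.hom F (ComplexShape.up ℤ)).f n
      rw [unitorInvDegree, unitorInvDegree, Category.assoc, Category.assoc, ι_mapBifunctorMap,
        id_f, F.map_id, NatTrans.id_app, Category.id_comp, ← NatTrans.naturality_assoc,
        ← NatTrans.naturality_assoc]
      rfl).symm

end Unitors

/-! ### Stability of one-sided projectivity -/

section ProjAlong

variable {k A B S : Type u} [Field k] [Ring A] [Algebra k A] [Ring B] [Algebra k B]
  [Ring S] [Algebra k S] {ρ : S →ₐ[k] A ⊗[k] Bᵐᵒᵖ}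

theorem IsProjAlong.of_isZero {X : FGBimod k A B} (hX : IsZero X) : IsProjAlong ρ X := by
  refine ⟨Empty, inferInstance, Empty.elim, fun i => i.elim, fun i => i.elim, fun y => ?_⟩
  have h : 𝟙 X = 0 := hX.eq_of_src _ _
  have hy : y = 0 := congr(($h).hom.hom y)
  simp [hy]

theorem IsProjAlong.of_iso {X Y : FGBimod k A B} (e : X ≅ Y) (hX : IsProjAlong ρ X) : IsProjAlong ρ Y :=
  IsProjAlong.of_sum {()} (fun _ => X) (fun _ => hX) (fun _ => e.inv) (fun _ => e.hom) fun x => by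
    rw [Finset.sum_singleton]
    exact congr(($e.inv_hom_id).hom.hom x)

end ProjAlong

/-! ### Tensoring with a bimodule resolution of the algebra -/

section Resolution

open HomologicalComplex

variable (k A B C : Type u) [Field k] [Ring A] [Algebra k A] [Ring B] [Algebra k B]
  [Ring C] [Algebra k C]
  [FiniteDimensional k A] [FiniteDimensional k B] [FiniteDimensional k C]

/-- The tensor product of bounded above complexes of bimodules. -/
abbrev tensorCMinus : CMinus (FGBimod k A B) ⥤ CMinus (FGBimod k B C) ⥤ CMinus (FGBimod k A C) :=
  mapBifunctorCMinus (tensorBimod k A B C)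

/-- A resolution of the bimodule `B` by projective bimodules. -/
def regularResolution : CMinus (FGBimod k B B) :=
  ⟨(projectiveResolution (regularBimod k B)).cochainComplex, 0, inferInstance⟩

instance (n : ℤ) : Projective ((regularResolution k B).obj.X n) :=
  inferInstanceAs (Projective ((projectiveResolution (regularBimod k B)).cochainComplex.X n))

/-- The augmentation of the resolution of `B`. -/
def regularAugmentation : regularResolution k B ⟶ singleCMinus (regularBimod k B) :=
  ObjectProperty.homMk (projectiveResolution (regularBimod k B)).π'

instance : QuasiIso (regularAugmentation k B).hom :=
  inferInstanceAs (QuasiIso (projectiveResolution (regularBimod k B)).π')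

instance : (regularResolution k B).obj.IsStrictlyLE 0 :=
  inferInstanceAs ((projectiveResolution (regularBimod k B)).cochainComplex.IsStrictlyLE 0)

instance : (singleCMinus (regularBimod k B)).obj.IsStrictlyLE 0 :=
  inferInstanceAs (((CochainComplex.singleFunctor _ 0).obj (regularBimod k B)).IsStrictlyLE 0)

variable {k A B C}

theorem isProjAlong_singleCMinus {S : Type u} [Ring S] [Algebra k S] {ρ : S →ₐ[k] A ⊗[k] Bᵐᵒᵖ}
    {X : FGBimod k A B} (hX : IsProjAlong ρ X) (n : ℤ) :
    IsProjAlong ρ ((singleCMinus X).obj.X n) := by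
  by_cases hn : n = 0
  · subst hn
    exact hX.of_iso (singleCMinusXZero X).symm
  · exact .of_isZero (isZero_singleCMinus_X X n hn)

theorem fgModuleCat_sum_apply {R : Type u} [Ring R] {X Y : FGModuleCat.{u} R} {J : Type*}
    (s : Finset J) (f : J → (X ⟶ Y)) (x : X) :
    (∑ j ∈ s, f j).hom.hom x = ∑ j ∈ s, (f j).hom.hom x := by
  classical
  induction s using Finset.induction_on with
  | empty => rfl
  | insert j s hj ih =>
    rw [Finset.sum_insert hj, Finset.sum_insert hj, ← ih]
    rfl

theorem isProjAlong_tensorCMinus {S : Type u} [Ring S] [Algebra k S] {ρ : S →ₐ[k] A ⊗[k] Cᵐᵒᵖ}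
    (K : CMinus (FGBimod k A B)) (L : CMinus (FGBimod k B C))
    (h : ∀ p q, IsProjAlong ρ (tensorObj (K.obj.X p) (L.obj.X q))) (n : ℤ) :
    IsProjAlong ρ ((((tensorCMinus k A B C).obj K).obj L).obj.X n) := by
  obtain ⟨s, hs⟩ := exists_sum_totalProj_totalIncl (F := tensorBimod k A B C) K L n
  refine IsProjAlong.of_sum s _ (fun p => h p (n - p)) (totalProj (tensorBimod k A B C) K L n)
    (totalIncl (tensorBimod k A B C) K L n) fun x => ?_
  exact (fgModuleCat_sum_apply s _ x).symm.trans congr(($hs).hom.hom x)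

/-- The resolution `P ⊗_B M ⟶ M`. -/
def resolutionCounit : (tensorCMinus k B B C).obj (regularResolution k B) ⟶ 𝟭 _ :=
  (tensorCMinus k B B C).map (regularAugmentation k B) ≫
    (unitorCMinus (tensorBimod k B B C) (tensorLeftUnitorIso k B C)).hom

theorem qis_map_left_of_isProjAlong {K K' : CMinus (FGBimod k A B)} (f : K ⟶ K') (hf : qis _ f)
    (L : CMinus (FGBimod k B C)) (hL : ∀ n, IsProjAlong
      (Algebra.TensorProduct.includeLeft : B →ₐ[k] B ⊗[k] Cᵐᵒᵖ) (L.obj.X n)) :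
    qis _ (((tensorCMinus k A B C).map f).app L) :=
  quasiIso_mapBifunctorMap_of_rows (tensorBimod k A B C) f L fun q =>
    have : QuasiIso f.hom := hf
    quasiIso_map_of_exact _ (exact_tensor_of_isProjAlong_includeLeft (hL q)) f.hom

theorem qis_map_right_of_isProjAlong (K : CMinus (FGBimod k A B)) (hK : ∀ n, IsProjAlong
      (Algebra.TensorProduct.includeRight : Bᵐᵒᵖ →ₐ[k] A ⊗[k] Bᵐᵒᵖ) (K.obj.X n))
    {L L' : CMinus (FGBimod k B C)} (f : L ⟶ L') (hf : qis _ f) :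
    qis _ (((tensorCMinus k A B C).obj K).map f) :=
  quasiIso_mapBifunctorMap_of_columns (tensorBimod k A B C) K f fun q =>
    have : QuasiIso f.hom := hf
    quasiIso_map_of_exact _ (exact_tensor_of_isProjAlong_includeRight (hK q)) f.hom

theorem qis_of_isIso {𝒜 : Type*} [Category* 𝒜] [HasZeroMorphisms 𝒜] [CategoryWithHomology 𝒜]
    {K L : CMinus 𝒜} (f : K ⟶ L) [IsIso f] : qis 𝒜 f := by
  have : IsIso f.hom := inferInstanceAs (IsIso ((boundedAbove 𝒜).ι.map f))
  exact inferInstanceAs (QuasiIso f.hom)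

/-- P_B and B both have right projective terms, so P_B → B stays a quasi-isomorphism after tensoring
with each term of `M`, hence on total complexes. The unit isomorphism finishes. -/
theorem qis_resolutionCounit_app (M : CMinus (FGBimod k B C)) :
    qis _ ((resolutionCounit (k := k) (B := B)).app M) := by
  refine (qis _).comp_mem _ _ ?_ (qis_of_isIso _)
  exact quasiIso_mapBifunctorMap_of_rows (tensorBimod k B B C) (regularAugmentation k B) M fun q =>
    quasiIso_tensor_right _ (fun n => isProjAlong_includeRight_of_projective _)
      (isProjAlong_singleCMinus isProjAlong_includeRight_regularBimod) 0 _

theorem exists_qis_tensor_regularResolution (L : CMinus (FGBimod k A B)) :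
    ∃ ε : ((tensorCMinus k A B B).obj L).obj (regularResolution k B) ⟶ L, qis _ ε := by
  -- The right unit isomorphism is the left one for the flipped bifunctor.
  let e := (mapBifunctorFlipIso L.obj (singleCMinus (regularBimod k B)).obj (tensorBimod k A B B)
    (ComplexShape.up ℤ)).symm ≪≫
      (unitorIso (tensorBimod k A B B).flip (tensorRightUnitorIso k A B) L).symm
  refine ⟨((tensorCMinus k A B B).obj L).map (regularAugmentation k B) ≫
    ((boundedAbove _).isoMk e).hom, (qis _).comp_mem _ _ ?_ (qis_of_isIso _)⟩
  exact quasiIso_mapBifunctorMap_of_columns (tensorBimod k A B B) L (regularAugmentation k B)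
    fun q => quasiIso_tensor_left _ (fun n => isProjAlong_includeLeft_of_projective _)
      (isProjAlong_singleCMinus isProjAlong_includeLeft_regularBimod) 0 _

theorem isProjAlong_regularResolution_tensor (M : CMinus (FGBimod k B C)) (n : ℤ) :
    IsProjAlong (Algebra.TensorProduct.includeLeft : B →ₐ[k] B ⊗[k] Cᵐᵒᵖ)
      ((((tensorCMinus k B B C).obj (regularResolution k B)).obj M).obj.X n) :=
  isProjAlong_tensorCMinus _ _
    (fun _ _ => isProjAlong_includeLeft_tensorObj (isProjAlong_id_of_projective _) _) n

theorem isProjAlong_tensor_regularResolution (L : CMinus (FGBimod k A B)) (n : ℤ) :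
    IsProjAlong (Algebra.TensorProduct.includeRight : Bᵐᵒᵖ →ₐ[k] A ⊗[k] Bᵐᵒᵖ)
      ((((tensorCMinus k A B B).obj L).obj (regularResolution k B)).obj.X n) :=
  isProjAlong_tensorCMinus _ _
    (fun _ _ => isProjAlong_includeRight_tensorObj _ (isProjAlong_id_of_projective _)) n

/-- Compare `L` with its right projective replacement L ⊗_B P_B. Tensoring with the replacement
preserves all quasi-isomorphisms, while the comparison L ⊗_B P_B → L stays one after tensoring with
the left projective `X` and `Y`. Two out of three in the naturality square gives the claim. -/
theorem qis_map_right (L : CMinus (FGBimod k A B)) {X Y : CMinus (FGBimod k B C)} (f : X ⟶ Y)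
    (hf : qis _ f)
    (hX : ∀ n, IsProjAlong (Algebra.TensorProduct.includeLeft : B →ₐ[k] B ⊗[k] Cᵐᵒᵖ) (X.obj.X n))
    (hY : ∀ n, IsProjAlong (Algebra.TensorProduct.includeLeft : B →ₐ[k] B ⊗[k] Cᵐᵒᵖ) (Y.obj.X n)) :
    qis _ (((tensorCMinus k A B C).obj L).map f) := by
  obtain ⟨ε, hε⟩ := exists_qis_tensor_regularResolution L
  have h₁ := qis_map_left_of_isProjAlong ε hε X hX
  have h₂ := qis_map_left_of_isProjAlong ε hε Y hY
  have h₃ := qis_map_right_of_isProjAlong _ (isProjAlong_tensor_regularResolution L) f hf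
  have h₄ := (qis _).comp_mem _ _ h₃ h₂
  rw [NatTrans.naturality] at h₄
  have h₁' : QuasiIso (((tensorCMinus k A B C).map ε).app X).hom := h₁
  have h₄' : QuasiIso ((((tensorCMinus k A B C).map ε).app X).hom ≫
    (((tensorCMinus k A B C).obj L).map f).hom) := h₄
  change QuasiIso (((tensorCMinus k A B C).obj L).map f).hom
  exact quasiIso_of_comp_left (((tensorCMinus k A B C).map ε).app X).hom _

end Resolution

/-! ### Existence and computation of the derived tensor product -/

section DerivedTensorExistence

variable (k A B C : Type u) [Field k] [Ring A] [Algebra k A] [Ring B] [Algebra k B]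
  [Ring C] [Algebra k C]
  [FiniteDimensional k A] [FiniteDimensional k B] [FiniteDimensional k C]

/-- The functorial resolution `(L, M) ↦ (L, P ⊗_B M)`. -/
def resolveRight : CMinus (FGBimod k A B) × CMinus (FGBimod k B C) ⥤
    CMinus (FGBimod k A B) × CMinus (FGBimod k B C) :=
  (𝟭 _).prod ((tensorCMinus k B B C).obj (regularResolution k B))

/-- The augmentation `(L, P ⊗_B M) ⟶ (L, M)`. -/
def resolveRightCounit : resolveRight k A B C ⟶ 𝟭 _ where
  app X := Prod.mkHom (𝟙 X.1) (resolutionCounit.app X.2)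
  naturality X Y f := by
    refine Prod.hom_ext ?_ ?_
    · exact (Category.comp_id _).trans (Category.id_comp _).symm
    · exact resolutionCounit.naturality f.2

theorem isIso_tensorToDerived_map {X Y : CMinus (FGBimod k A B) × CMinus (FGBimod k B C)}
    (f : X ⟶ Y) (h₁ : qis _ (((tensorCMinus k A B C).map f.1).app X.2))
    (h₂ : qis _ (((tensorCMinus k A B C).obj Y.1).map f.2)) :
    IsIso ((tensorToDerived k A B C).map f) :=
  Localization.inverts (qis (FGBimod k A C)).Q (qis _) _ ((qis _).comp_mem _ _ h₁ h₂)

/-- In the first variable, P_B ⊗_B M is left projective. In the second, P_B ⊗_B - preserves the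
quasi-isomorphism because P_B is right projective, and `qis_map_right` handles the remaining factor.
-/
theorem isInvertedBy_resolveRight :
    ((qis (FGBimod k A B)).prod (qis (FGBimod k B C))).IsInvertedBy
      (resolveRight k A B C ⋙ tensorToDerived k A B C) := fun X Y f hf =>
  isIso_tensorToDerived_map k A B C ((resolveRight k A B C).map f)
    (qis_map_left_of_isProjAlong f.1 hf.1 _ (isProjAlong_regularResolution_tensor X.2))
    (qis_map_right _ _ (qis_map_right_of_isProjAlong _
      (fun _ => isProjAlong_includeRight_of_projective _) f.2 hf.2)
      (isProjAlong_regularResolution_tensor X.2) (isProjAlong_regularResolution_tensor Y.2))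

theorem isLeftDerivedFunctor_resolveRight :
    (Localization.lift (resolveRight k A B C ⋙ tensorToDerived k A B C)
      (isInvertedBy_resolveRight k A B C)
      ((qis (FGBimod k A B)).Q.prod (qis (FGBimod k B C)).Q)).IsLeftDerivedFunctor
      (deformationCounit ((qis (FGBimod k A B)).Q.prod (qis (FGBimod k B C)).Q)
        ((qis (FGBimod k A B)).prod (qis (FGBimod k B C))) (tensorToDerived k A B C)
        (resolveRightCounit k A B C) (isInvertedBy_resolveRight k A B C))
      ((qis (FGBimod k A B)).prod (qis (FGBimod k B C))) :=
  isLeftDerivedFunctor_of_deformation _ _ _ _ _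
    (fun X => ⟨(qis _).id_mem _, qis_resolutionCounit_app X.2⟩)
    -- On a resolved object the counit compares P_B ⊗ (P_B ⊗ M) with P_B ⊗ M, both left projective,
    -- so `qis_map_right` applies.
    (fun X => isIso_tensorToDerived_map k A B C _
      (qis_of_isIso (((tensorCMinus k A B C).map (𝟙 X.1)).app _))
      (qis_map_right _ _ (qis_resolutionCounit_app _)
        (isProjAlong_regularResolution_tensor _) (isProjAlong_regularResolution_tensor _)))

theorem hasDerivedTensor : HasDerivedTensor k A B C :=
  have := isLeftDerivedFunctor_resolveRight k A B C
  Functor.HasLeftDerivedFunctor.mk' _ (deformationCounit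
    ((qis (FGBimod k A B)).Q.prod (qis (FGBimod k B C)).Q)
    ((qis (FGBimod k A B)).prod (qis (FGBimod k B C))) (tensorToDerived k A B C)
    (resolveRightCounit k A B C) (isInvertedBy_resolveRight k A B C))

/-- The bifunctor `(L, M) ↦ L ⊗_B (P ⊗_B M)`, where `P` is the resolution of `B`. -/
def resolvedTensor :
    CMinus (FGBimod k A B) ⥤ CMinus (FGBimod k B C) ⥤ CMinus (FGBimod k A C) :=
  tensorCMinus k A B C ⋙
    (Functor.whiskeringLeft _ _ _).obj ((tensorCMinus k B B C).obj (regularResolution k B))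

/-- The derived tensor product is computed by `L ⊗_B (P ⊗_B M)`. -/
def prodCompTotalLeftDerivedIso [HasDerivedTensor k A B C] :
    (qis (FGBimod k A B)).Q.prod (qis (FGBimod k B C)).Q ⋙
      (tensorToDerived k A B C).totalLeftDerived
        ((qis (FGBimod k A B)).Q.prod (qis (FGBimod k B C)).Q)
        ((qis (FGBimod k A B)).prod (qis (FGBimod k B C))) ≅
    resolveRight k A B C ⋙ tensorToDerived k A B C :=
  have := isLeftDerivedFunctor_resolveRight k A B C
  Functor.isoWhiskerLeft _ (Functor.leftDerivedUnique _ _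
    ((tensorToDerived k A B C).totalLeftDerivedCounit
      ((qis (FGBimod k A B)).Q.prod (qis (FGBimod k B C)).Q)
      ((qis (FGBimod k A B)).prod (qis (FGBimod k B C))))
    (deformationCounit
      ((qis (FGBimod k A B)).Q.prod (qis (FGBimod k B C)).Q)
      ((qis (FGBimod k A B)).prod (qis (FGBimod k B C))) (tensorToDerived k A B C)
      (resolveRightCounit k A B C) (isInvertedBy_resolveRight k A B C))
    ((qis (FGBimod k A B)).prod (qis (FGBimod k B C)))) ≪≫
  Localization.fac (resolveRight k A B C ⋙ tensorToDerived k A B C)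
      (isInvertedBy_resolveRight k A B C) _

/-- Precomposition in the second variable, before and after currying. -/
def curryProdCompUncurryIso {C₁ C₂ C₁₂ H : Type*} [Category* C₁] [Category* C₂] [Category* C₁₂]
    [Category* H] (F : C₁ ⥤ C₂ ⥤ C₁₂) (P : C₂ ⥤ C₂) (L : C₁₂ ⥤ H) :
    Functor.curry.obj ((𝟭 C₁).prod P ⋙ Functor.uncurry.obj F ⋙ L) ≅
      (F ⋙ (Functor.whiskeringLeft _ _ _).obj P) ⋙ (Functor.whiskeringRight _ _ _).obj L :=
  NatIso.ofComponents (fun X₁ => NatIso.ofComponents (fun X₂ => Iso.refl _)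
    (by intros; simp)) (by intros; ext; simp)

/-- This presents the derived tensor product, up to isomorphism, as the descent of a bifunctor on
complexes, the form in which an associator passes to localizations. -/
instance [HasDerivedTensor k A B C] : Localization.Lifting₂ (qis (FGBimod k A B)).Q
    (qis (FGBimod k B C)).Q (qis (FGBimod k A B)) (qis (FGBimod k B C))
    (resolvedTensor k A B C ⋙ (Functor.whiskeringRight _ _ _).obj (qis (FGBimod k A C)).Q)
    (derivedTensor k A B C) where
  iso := (Functor.curryObjProdComp _ _ _).symm ≪≫
    Functor.curry.mapIso (prodCompTotalLeftDerivedIso k A B C) ≪≫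
      curryProdCompUncurryIso _ _ _

end DerivedTensorExistence

/-! ### Associativity on complexes and its descent -/

section Associativity

section

variable {C₁ C₂ C₃ C₁₂ C₂₃ C₄ : Type*} [Category* C₁] [Category* C₂] [Category* C₃] [Category* C₁₂]
  [Category* C₂₃] [Category* C₄] {F₁₂ : C₁ ⥤ C₂ ⥤ C₁₂} {G : C₁₂ ⥤ C₃ ⥤ C₄} {F : C₁ ⥤ C₂₃ ⥤ C₄}
  {G₂₃ : C₂ ⥤ C₃ ⥤ C₂₃} {P : C₂ ⥤ C₂} {P₂₃ : C₂₃ ⥤ C₂₃}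

/-- An associativity isomorphism for bifunctors whose second variables are replaced by functors
of them. -/
def bifunctorCompPrecompIso (a : bifunctorComp₁₂ F₁₂ G ≅ bifunctorComp₂₃ F G₂₃)
    (b : P ⋙ G₂₃ ≅ G₂₃ ⋙ (Functor.whiskeringRight _ _ _).obj P₂₃) (P' : C₃ ⥤ C₃) :
    bifunctorComp₁₂ (F₁₂ ⋙ (Functor.whiskeringLeft _ _ _).obj P)
      (G ⋙ (Functor.whiskeringLeft _ _ _).obj P') ≅
    bifunctorComp₂₃ (F ⋙ (Functor.whiskeringLeft _ _ _).obj P₂₃)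
      (G₂₃ ⋙ (Functor.whiskeringLeft _ _ _).obj P') :=
  let α (X₁ : C₁) (X₂ : C₂) (X₃ : C₃) : (G.obj ((F₁₂.obj X₁).obj X₂)).obj X₃ ≅
    (F.obj X₁).obj ((G₂₃.obj X₂).obj X₃) := ((a.app X₁).app X₂).app X₃
  let β (X₂ : C₂) (X₃ : C₃) : (G₂₃.obj (P.obj X₂)).obj X₃ ≅ P₂₃.obj ((G₂₃.obj X₂).obj X₃) :=
    (b.app X₂).app X₃
  have hα₁ {X₁ Y₁ : C₁} (f : X₁ ⟶ Y₁) (X₂ : C₂) (X₃ : C₃) :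
      (G.map ((F₁₂.map f).app X₂)).app X₃ ≫ (α Y₁ X₂ X₃).hom =
        (α X₁ X₂ X₃).hom ≫ (F.map f).app ((G₂₃.obj X₂).obj X₃) :=
    NatTrans.congr_app (NatTrans.congr_app (a.hom.naturality f) X₂) X₃
  have hα₂ (X₁ : C₁) {X₂ Y₂ : C₂} (f : X₂ ⟶ Y₂) (X₃ : C₃) :
      (G.map ((F₁₂.obj X₁).map f)).app X₃ ≫ (α X₁ Y₂ X₃).hom =
        (α X₁ X₂ X₃).hom ≫ (F.obj X₁).map ((G₂₃.map f).app X₃) :=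
    NatTrans.congr_app ((a.hom.app X₁).naturality f) X₃
  have hα₃ (X₁ : C₁) (X₂ : C₂) {X₃ Y₃ : C₃} (f : X₃ ⟶ Y₃) :
      (G.obj ((F₁₂.obj X₁).obj X₂)).map f ≫ (α X₁ X₂ Y₃).hom =
        (α X₁ X₂ X₃).hom ≫ (F.obj X₁).map ((G₂₃.obj X₂).map f) :=
    ((a.hom.app X₁).app X₂).naturality f
  have hβ₂ {X₂ Y₂ : C₂} (f : X₂ ⟶ Y₂) (X₃ : C₃) :
      (G₂₃.map (P.map f)).app X₃ ≫ (β Y₂ X₃).hom =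
        (β X₂ X₃).hom ≫ P₂₃.map ((G₂₃.map f).app X₃) :=
    NatTrans.congr_app (b.hom.naturality f) X₃
  have hβ₃ (X₂ : C₂) {X₃ Y₃ : C₃} (f : X₃ ⟶ Y₃) :
      (G₂₃.obj (P.obj X₂)).map f ≫ (β X₂ Y₃).hom =
        (β X₂ X₃).hom ≫ P₂₃.map ((G₂₃.obj X₂).map f) :=
    (b.hom.app X₂).naturality f
  NatIso.ofComponents (fun X₁ => NatIso.ofComponents (fun X₂ => NatIso.ofComponents
    (fun X₃ => α X₁ (P.obj X₂) (P'.obj X₃) ≪≫ (F.obj X₁).mapIso (β X₂ (P'.obj X₃)))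
    (fun {X₃ Y₃} f => by
      change (G.obj ((F₁₂.obj X₁).obj (P.obj X₂))).map (P'.map f) ≫
        (α X₁ (P.obj X₂) (P'.obj Y₃)).hom ≫ (F.obj X₁).map (β X₂ (P'.obj Y₃)).hom =
        ((α X₁ (P.obj X₂) (P'.obj X₃)).hom ≫ (F.obj X₁).map (β X₂ (P'.obj X₃)).hom) ≫
          (F.obj X₁).map (P₂₃.map ((G₂₃.obj X₂).map (P'.map f)))
      clear_value α β
      rw [reassoc_of% hα₃, ← Functor.map_comp, hβ₃, Functor.map_comp, Category.assoc]))
    (fun {X₂ Y₂} f => by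
      ext X₃ : 2
      change (G.map ((F₁₂.obj X₁).map (P.map f))).app (P'.obj X₃) ≫
        (α X₁ (P.obj Y₂) (P'.obj X₃)).hom ≫ (F.obj X₁).map (β Y₂ (P'.obj X₃)).hom =
        ((α X₁ (P.obj X₂) (P'.obj X₃)).hom ≫ (F.obj X₁).map (β X₂ (P'.obj X₃)).hom) ≫
          (F.obj X₁).map (P₂₃.map ((G₂₃.map f).app (P'.obj X₃)))
      clear_value α β
      rw [reassoc_of% hα₂, ← Functor.map_comp, hβ₂, Functor.map_comp, Category.assoc]))
    (fun {X₁ Y₁} f => by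
      ext X₂ X₃ : 4
      change (G.map ((F₁₂.map f).app (P.obj X₂))).app (P'.obj X₃) ≫
        (α Y₁ (P.obj X₂) (P'.obj X₃)).hom ≫ (F.obj Y₁).map (β X₂ (P'.obj X₃)).hom =
        ((α X₁ (P.obj X₂) (P'.obj X₃)).hom ≫ (F.obj X₁).map (β X₂ (P'.obj X₃)).hom) ≫
          (F.map f).app (P₂₃.obj ((G₂₃.obj X₂).obj (P'.obj X₃)))
      clear_value α β
      rw [reassoc_of% hα₁, Category.assoc, NatTrans.naturality])

end

variable (k A B C D : Type u) [Field k] [Ring A] [Algebra k A] [Ring B] [Algebra k B]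
  [Ring C] [Algebra k C] [Ring D] [Algebra k D]
  [FiniteDimensional k A] [FiniteDimensional k B] [FiniteDimensional k C] [FiniteDimensional k D]

/-- The isomorphism `(L ⊗ (P_B ⊗ M)) ⊗ (P_C ⊗ N) ≅ L ⊗ (P_B ⊗ (M ⊗ (P_C ⊗ N)))`. -/
def resolvedTensorAssoc : bifunctorComp₁₂ (resolvedTensor k A B C) (resolvedTensor k A C D) ≅
    bifunctorComp₂₃ (resolvedTensor k A B D) (resolvedTensor k B C D) :=
  bifunctorCompPrecompIso (associatorCMinus (tensorAssocIso k A B C D))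
    ((associatorCMinus (tensorAssocIso k B B C D)).app (regularResolution k B)) _

/-- Each derived tensor product lifts its resolved version, so `resolvedTensorAssoc` induces the
isomorphism on the localized categories. -/
theorem exists_derivedTensor_associator :
    ∃ (_ : HasDerivedTensor k A B C) (_ : HasDerivedTensor k A C D)
      (_ : HasDerivedTensor k A B D) (_ : HasDerivedTensor k B C D),
      Nonempty (bifunctorComp₁₂ (derivedTensor k A B C) (derivedTensor k A C D) ≅
        bifunctorComp₂₃ (derivedTensor k A B D) (derivedTensor k B C D)) :=
  have h₁ := hasDerivedTensor k A B C
  have h₂ := hasDerivedTensor k A C D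
  have h₃ := hasDerivedTensor k A B D
  have h₄ := hasDerivedTensor k B C D
  ⟨h₁, h₂, h₃, h₄, ⟨Localization.associator (qis (FGBimod k A B)).Q (qis (FGBimod k B C)).Q
    (qis (FGBimod k C D)).Q (qis (FGBimod k A C)).Q (qis (FGBimod k B D)).Q (qis (FGBimod k A D)).Q
    (qis (FGBimod k A B)) (qis (FGBimod k B C)) (qis (FGBimod k C D)) (qis (FGBimod k A C))
    (qis (FGBimod k B D)) (resolvedTensorAssoc k A B C D)
    (derivedTensor k A B C) (derivedTensor k A C D)
    (derivedTensor k A B D) (derivedTensor k B C D)⟩⟩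

end Associativity

end DerivedTensor

end

/-- The derived tensor products over `B` and `C` exist, and `(L ⊗ᴸ_B M) ⊗ᴸ_C N` and
`L ⊗ᴸ_B (M ⊗ᴸ_C N)` are isomorphic as functors of the triple
`(L, M, N)` in `D⁻(A ⊗ Bᵒᵖ) × D⁻(B ⊗ Cᵒᵖ) × D⁻(C ⊗ Dᵒᵖ)`. Fixing any two of the three variables,
for instance as bounded complexes, gives the isomorphisms of functors in the remaining one. -/
theorem lemma2p3 (k A B C D : Type u) [Field k]
    [Ring A] [Algebra k A] [FiniteDimensional k A]
    [Ring B] [Algebra k B] [FiniteDimensional k B]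
    [Ring C] [Algebra k C] [FiniteDimensional k C]
    [Ring D] [Algebra k D] [FiniteDimensional k D] :
    ∃ (_ : DerivedTensor.HasDerivedTensor k A B C) (_ : DerivedTensor.HasDerivedTensor k A C D)
      (_ : DerivedTensor.HasDerivedTensor k A B D) (_ : DerivedTensor.HasDerivedTensor k B C D),
      Nonempty (bifunctorComp₁₂ (DerivedTensor.derivedTensor k A B C) (DerivedTensor.derivedTensor k A C D) ≅
        bifunctorComp₂₃ (DerivedTensor.derivedTensor k A B D) (DerivedTensor.derivedTensor k B C D)) := by
  exact DerivedTensor.exists_derivedTensor_associator k A B C D
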